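/- Let $m\ge 2$. For a tuple $\mathcal C=(C_1,\dots,C_m)$ of cameras, i.e. complex $3\times 4$ matrices of rank $3$ with pairwise distinct centers $c_i=\ker C_i\in\mathbb P^3$, let $\mathcal L_{\mathcal C}\subseteq(\mathbb P^2)^m$ (over $\mathbb C$) be the line multiview variety: the Zariski closure of the set of tuples $(C_1\cdot L,\dots,C_m\cdot L)$, where $L$ runs over the lines in $\mathbb P^3$ that pass through none of the centers, and where the line $C_i\cdot L\subset\mathbb P^2$ is identified with the point $\ell_i\in\mathbb P^2$ such that $C_i\cdot L=\{x : x^T\ell_i=0\}$. For $d=(d_1,\dots,d_m)\in\mathbb N^m$ with $d_1+\cdots+d_m=4$, the multidegree of $\mathcal L_{\mathcal C}$ at $d$ is $$D(d_1,\dots,d_m)=\#\bigl(\mathcal L_{\mathcal C}\cap(L^{(1)}_{d_1}\times\cdots\times L^{(m)}_{d_m})\bigr),$$ where $L^{(i)}_{d_i}\subseteq\mathbb P^2$ is a general linear subspace of codimension $d_i$, i.e. the zero set of $d_i$ general linear forms (it is empty if $d_i\ge3$). Here "general" means: for all choices of coefficients in some nonempty Zariski open subset of the space of all coefficients. Theorem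 4.1. For general cameras, that is, for all $\mathcal C$ in some nonempty Zariski open subset of $(\mathbb C^{3\times4})^m$ that consists of tuples of rank-$3$ matrices with pairwise distinct centers, no four of them collinear, the multidegree of $\mathcal L_{\mathcal C}$ is given, up to permutation of the entries of $d$, by $$D(2,2,0,\dots,0)=1,\qquad D(2,1,1,0,\dots,0)=1\ \ (m\ge3),\qquad D(1,1,1,1,0,\dots,0)=2\ \ (m\ge4).$$ That is, $D(d)$ has the stated value whenever $d$ is a permutation of one of these three vectors, and $D(d)=0$ for all other $d$ with $d_1+\cdots+d_m=4$ (those with some $d_i\ge3$). -/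

import Mathlib

/-- The complex projective plane `ℙ²`. -/
abbrev PTwo : Type := Projectivization ℂ (Fin 3 → ℂ)

/-- A property of a point of the affine space `ℂ^σ` holds for a general point if it holds at every
point of some nonempty (hence dense) Zariski open subset. Since every nonempty Zariski open subset
contains a nonempty principal one, this is: it holds wherever some nonzero polynomial does not
vanish. -/
def HoldsGenerically {σ : Type} (P : (σ → ℂ) → Prop) : Prop :=
  ∃ p : MvPolynomial σ ℂ, p ≠ 0 ∧ ∀ a : σ → ℂ, MvPolynomial.eval a p ≠ 0 → P a

/-- The variable `(i, k)` is the `k`-th coordinate on the `i`-th factor of `(ℙ²)^m`; the polynomial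
`p` is multihomogeneous if, for some `e`, it is homogeneous of degree `e i` in the `i`-th group of
variables, for every `i`. -/
def IsMultihomogeneous {m : ℕ} (p : MvPolynomial (Fin m × Fin 3) ℂ) : Prop :=
  ∃ e : Fin m → ℕ,
    MvPolynomial.IsWeightedHomogeneous (fun v : Fin m × Fin 3 => (Pi.single v.1 1 : Fin m → ℕ)) p e

/-- `p` vanishes at the point `x` of `(ℙ²)^m`. For multihomogeneous `p` this does not depend on the
representatives. -/
def VanishesAt {m : ℕ} (p : MvPolynomial (Fin m × Fin 3) ℂ) (x : Fin m → PTwo) : Prop :=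
  MvPolynomial.eval (fun v : Fin m × Fin 3 => (x v.1).rep v.2) p = 0

/-- The Zariski closure of a subset of `(ℙ²)^m`: the common zeros of all the multihomogeneous
polynomials that vanish on it. -/
def zariskiClosure {m : ℕ} (S : Set (Fin m → PTwo)) : Set (Fin m → PTwo) :=
  {x | ∀ p : MvPolynomial (Fin m × Fin 3) ℂ, IsMultihomogeneous p →
    (∀ y ∈ S, VanishesAt p y) → VanishesAt p x}

/-- The kernel of a camera matrix; for a matrix of rank 3 it is a line in `ℂ⁴`, that is, a point of
`ℙ³`, the camera center. -/
def cameraCenter (C : Matrix (Fin 3) (Fin 4) ℂ) : Submodule ℂ (Fin 4 → ℂ) :=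
  LinearMap.ker C.mulVecLin

/-- Arrangements of pinhole cameras with different centers. -/
structure IsCameraArrangement {m : ℕ} (C : Fin m → Matrix (Fin 3) (Fin 4) ℂ) : Prop where
  rank_eq : ∀ i, (C i).rank = 3
  center_ne : ∀ i j, i ≠ j → cameraCenter (C i) ≠ cameraCenter (C j)

/-- No four of the camera centers lie on a line of `ℙ³`. -/
def NoFourCollinear {m : ℕ} (C : Fin m → Matrix (Fin 3) (Fin 4) ℂ) : Prop :=
  ∀ i j k l : Fin m, [i, j, k, l].Nodup →
    2 < Module.finrank ℂ ↥(cameraCenter (C i) ⊔ cameraCenter (C j) ⊔ cameraCenter (C k) ⊔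
      cameraCenter (C l))

/-- The line `{x | xᵀ ℓ = 0}` of `ℙ²` with equation `ℓ`, as a linear subspace of `ℂ³`. -/
noncomputable def imageLine (ℓ : PTwo) : Submodule ℂ (Fin 3 → ℂ) :=
  LinearMap.ker (dotProductBilin ℂ ℂ ℓ.rep)

/-- The camera `C` maps the line `L` of `ℙ³` (a two-dimensional subspace of `ℂ⁴`) to the line with
equation `ℓ`: the line `L` does not pass through the camera center, and `C · L = ℓ`. -/
def CameraMaps (C : Matrix (Fin 3) (Fin 4) ℂ) (L : Submodule ℂ (Fin 4 → ℂ)) (ℓ : PTwo) : Prop :=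
  Disjoint L (cameraCenter C) ∧ L.map C.mulVecLin = imageLine ℓ

/-- The image of the joint camera map `L ↦ (C₁ · L, …, C_m · L)`, which is defined on the lines of
`ℙ³` that meet no camera center. -/
def jointCameraImage {m : ℕ} (C : Fin m → Matrix (Fin 3) (Fin 4) ℂ) : Set (Fin m → PTwo) :=
  {ℓ | ∃ L : Submodule ℂ (Fin 4 → ℂ), Module.finrank ℂ L = 2 ∧ ∀ i, CameraMaps (C i) L (ℓ i)}

/-- The line multiview variety. -/
def lineMultiviewVariety {m : ℕ} (C : Fin m → Matrix (Fin 3) (Fin 4) ℂ) : Set (Fin m → PTwo) :=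
  zariskiClosure (jointCameraImage C)

/-- The product `L⁽¹⁾ × ⋯ × L⁽ᵐ⁾ ⊆ (ℙ²)^m`, where `L⁽ⁱ⁾` is the linear subspace of `ℙ²` cut out by
`d i` linear forms, with coefficient vectors `a (⟨i, j⟩, ·)`. For general coefficients `L⁽ⁱ⁾` is a
general linear subspace of codimension `d i` (the empty one if `3 ≤ d i`). -/
def linearSubspaceProduct {m : ℕ} (d : Fin m → ℕ) (a : (Σ i : Fin m, Fin (d i)) × Fin 3 → ℂ) :
    Set (Fin m → PTwo) :=
  {ℓ | ∀ (i : Fin m) (j : Fin (d i)), ∑ k : Fin 3, a (⟨i, j⟩, k) * (ℓ i).rep k = 0}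

/-- The multidegree of `X ⊆ (ℙ²)^m` takes the value `n` at `d`: for general linear subspaces
`L⁽ⁱ⁾ ⊆ ℙ²` of codimension `d i`, the set `X ∩ (L⁽¹⁾ × ⋯ × L⁽ᵐ⁾)` has exactly `n` points. -/
def MultidegreeEq {m : ℕ} (X : Set (Fin m → PTwo)) (d : Fin m → ℕ) (n : ℕ) : Prop :=
  HoldsGenerically fun a : (Σ i : Fin m, Fin (d i)) × Fin 3 → ℂ =>
    (X ∩ linearSubspaceProduct d a).encard = n

/-- The tuple of `m` matrices of size `3 × 4` with the given entries. -/
def cameraTuple {m : ℕ} (a : Fin m × Fin 3 × Fin 4 → ℂ) : Fin m → Matrix (Fin 3) (Fin 4) ℂ :=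
  fun i => Matrix.of fun j k => a (i, j, k)

/-! ### Polynomial functions and general points -/

open Module (finrank)
open scoped Matrix

/-! Back-projection sends a point `ℓ` of `(ℙ²)^m` to the planes `(ℓ n).rep ᵥ* C n`, one through each
camera center. Two facts about the variety suffice. It contains every actual image, and on it any
three back-projected planes are linearly dependent, because this trilinear condition holds on images
and is closed (`det4_eq_zero_of_mem_lineMultiviewVariety`). Hence, if two of the planes differ and
the line where they meet avoids all centers, the point is the image of that line
(`cameraMaps_of_mem_lineMultiviewVariety`). The full ideal of the closure is never needed.

The count thus becomes one of lines in `ℙ³`. One linear form in view `i` makes the line meet a fixed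
ray through the center of camera `i`, the axis of a pencil of planes; two forms fix the
back-projected plane. So (2,2) asks for the intersection of two planes
(`exists_eq_singleton_of_two_points`). (2,1,1) asks for the line in a plane that joins its
intersection points with two rays (`exists_eq_singleton_of_point_of_two_lines`). (1,1,1,1) asks for
the transversals of four rays, which correspond to the two roots of a binary quadratic form
(`encard_eq_two_of_four_lines`). An entry at least 3 makes the linear section empty.

Each argument needs only that certain polynomials in the cameras and the forms jointly do not
vanish. A single point with nonzero value shows that such a polynomial is nonzero, and
`HoldsGenerically.curry` turns general pairs into general forms for general cameras. -/

/-- A complex function on `ℂ^σ` that is given by a polynomial. -/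
def IsPolyFun {σ : Type} (f : (σ → ℂ) → ℂ) : Prop :=
  ∃ p : MvPolynomial σ ℂ, ∀ a, f a = MvPolynomial.eval a p

namespace IsPolyFun

variable {σ : Type} {f g : (σ → ℂ) → ℂ}

theorem const (c : ℂ) : IsPolyFun fun _ : σ → ℂ => c := ⟨MvPolynomial.C c, by simp⟩

theorem coord (v : σ) : IsPolyFun fun a : σ → ℂ => a v := ⟨MvPolynomial.X v, by simp⟩

theorem add (hf : IsPolyFun f) (hg : IsPolyFun g) : IsPolyFun fun a => f a + g a := by
  obtain ⟨p, hp⟩ := hf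
  obtain ⟨q, hq⟩ := hg
  exact ⟨p + q, by simp [hp, hq]⟩

theorem sub (hf : IsPolyFun f) (hg : IsPolyFun g) : IsPolyFun fun a => f a - g a := by
  obtain ⟨p, hp⟩ := hf
  obtain ⟨q, hq⟩ := hg
  exact ⟨p - q, by simp [hp, hq]⟩

theorem mul (hf : IsPolyFun f) (hg : IsPolyFun g) : IsPolyFun fun a => f a * g a := by
  obtain ⟨p, hp⟩ := hf
  obtain ⟨q, hq⟩ := hg
  exact ⟨p * q, by simp [hp, hq]⟩

theorem sum {ι : Type} (s : Finset ι) {F : ι → (σ → ℂ) → ℂ} (h : ∀ i, IsPolyFun (F i)) :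
    IsPolyFun fun a => ∑ i ∈ s, F i a := by
  choose p hp using h
  exact ⟨∑ i ∈ s, p i, by simp [hp]⟩

theorem prod {ι : Type} (s : Finset ι) {F : ι → (σ → ℂ) → ℂ} (h : ∀ i, IsPolyFun (F i)) :
    IsPolyFun fun a => ∏ i ∈ s, F i a := by
  choose p hp using h
  exact ⟨∏ i ∈ s, p i, by simp [hp]⟩

theorem det {n : ℕ} {M : (σ → ℂ) → Matrix (Fin n) (Fin n) ℂ}
    (h : ∀ i j, IsPolyFun fun a => M a i j) : IsPolyFun fun a => (M a).det := by
  simp only [Matrix.det_apply']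
  exact sum _ fun _ => mul (const _) (prod _ fun _ => h _ _)

theorem dotProduct {n : ℕ} {u v : (σ → ℂ) → Fin n → ℂ} (hu : ∀ i, IsPolyFun fun a => u a i)
    (hv : ∀ i, IsPolyFun fun a => v a i) : IsPolyFun fun a => u a ⬝ᵥ v a :=
  sum _ fun _ => mul (hu _) (hv _)

theorem holdsGenerically (hf : IsPolyFun f) (h : ∃ a, f a ≠ 0) :
    HoldsGenerically fun a => f a ≠ 0 := by
  obtain ⟨p, hp⟩ := hf
  obtain ⟨a, ha⟩ := h
  refine ⟨p, ?_, fun b hb => by simpa only [hp] using hb⟩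
  rintro rfl
  exact ha (by simp [hp])

end IsPolyFun

namespace HoldsGenerically

variable {σ τ : Type} {P Q : (σ → ℂ) → Prop}

theorem mono (h : HoldsGenerically P) (hPQ : ∀ a, P a → Q a) : HoldsGenerically Q := by
  obtain ⟨p, hp, h⟩ := h
  exact ⟨p, hp, fun a ha => hPQ a (h a ha)⟩

theorem of_forall (h : ∀ a, P a) : HoldsGenerically P := ⟨1, one_ne_zero, fun a _ => h a⟩

theorem and (hP : HoldsGenerically P) (hQ : HoldsGenerically Q) :
    HoldsGenerically fun a => P a ∧ Q a := by
  obtain ⟨p, hp, hP⟩ := hP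
  obtain ⟨q, hq, hQ⟩ := hQ
  refine ⟨p * q, mul_ne_zero hp hq, fun a ha => ?_⟩
  rw [map_mul] at ha
  exact ⟨hP a (left_ne_zero_of_mul ha), hQ a (right_ne_zero_of_mul ha)⟩

theorem all {ι : Type} [Fintype ι] {R : ι → (σ → ℂ) → Prop} (h : ∀ i, HoldsGenerically (R i)) :
    HoldsGenerically fun a => ∀ i, R i a := by
  choose p hp h using h
  refine ⟨∏ i, p i, Finset.prod_ne_zero_iff.2 fun i _ => hp i, fun a ha i => h i a ?_⟩
  rw [MvPolynomial.eval_prod] at ha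
  exact Finset.prod_ne_zero_iff.1 ha i (Finset.mem_univ i)

theorem imp {A : Prop} (h : A → HoldsGenerically P) : HoldsGenerically fun a => A → P a := by
  by_cases hA : A
  · exact (h hA).mono fun a ha _ => ha
  · exact of_forall fun a h => (hA h).elim

theorem sumInl (h : HoldsGenerically P) :
    HoldsGenerically fun x : σ ⊕ τ → ℂ => P fun v => x (.inl v) := by
  obtain ⟨p, hp, h⟩ := h
  refine ⟨MvPolynomial.rename Sum.inl p, fun h0 => hp ?_, fun x hx => h _ ?_⟩
  · exact MvPolynomial.rename_injective _ Sum.inl_injective (by rw [h0, map_zero])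
  · rwa [MvPolynomial.eval_rename] at hx

/-- A property that holds for a general point of a product of affine spaces holds for a general
second component, if the first one is general. -/
theorem curry {R : (σ → ℂ) → (τ → ℂ) → Prop}
    (h : HoldsGenerically fun x : σ ⊕ τ → ℂ => R (fun v => x (.inl v)) fun v => x (.inr v)) :
    HoldsGenerically fun a => HoldsGenerically (R a) := by
  obtain ⟨p, hp, h⟩ := h
  obtain ⟨x, hx⟩ : ∃ x, MvPolynomial.eval x p ≠ 0 := by
    by_contra! hx
    exact hp (MvPolynomial.funext fun x => by simp [hx])
  have key (a : σ → ℂ) (b : τ → ℂ) :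
      MvPolynomial.eval a (MvPolynomial.aeval
          (Sum.elim MvPolynomial.X fun v => MvPolynomial.C (b v)) p) =
        MvPolynomial.eval (Sum.elim a b) p := by
    rw [← MvPolynomial.coe_aeval_eq_eval, RingHom.coe_coe, ← AlgHom.comp_apply,
      MvPolynomial.comp_aeval, MvPolynomial.aeval_eq_eval]
    congr 2
    funext v
    cases v <;> simp
  have key' (a : σ → ℂ) (b : τ → ℂ) :
      MvPolynomial.eval b (MvPolynomial.aeval
          (Sum.elim (fun v => MvPolynomial.C (a v)) MvPolynomial.X) p) =
        MvPolynomial.eval (Sum.elim a b) p := by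
    rw [← MvPolynomial.coe_aeval_eq_eval, RingHom.coe_coe, ← AlgHom.comp_apply,
      MvPolynomial.comp_aeval, MvPolynomial.aeval_eq_eval]
    congr 2
    funext v
    cases v <;> simp
  have hx' : MvPolynomial.eval (Sum.elim (fun v => x (.inl v)) fun v => x (.inr v)) p ≠ 0 := by
    convert hx using 3
    funext v
    cases v <;> rfl
  -- The polynomial in `a` is `p` with the second block frozen at a point where `p` is nonzero.
  -- Where it does not vanish, `p` with first block `a` is a nonzero polynomial in `b`, as its value
  -- at that same frozen point shows.
  refine ⟨MvPolynomial.aeval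
    (Sum.elim MvPolynomial.X fun v => MvPolynomial.C (x (.inr v))) p, fun h0 => hx' ?_,
    fun a ha => ⟨MvPolynomial.aeval
      (Sum.elim (fun v => MvPolynomial.C (a v)) MvPolynomial.X) p, fun h0 => ha ?_, fun b hb => ?_⟩⟩
  · rw [← key, h0, map_zero]
  · rw [key, ← key', h0, map_zero]
  · exact h (Sum.elim a b) (by rwa [← key'])

end HoldsGenerically

/-! ### Determinants of four planes -/

/-- The determinant of the `4 × 4` matrix with the given rows. -/
noncomputable def det4 (u v w x : Fin 4 → ℂ) : ℂ := (Matrix.of ![u, v, w, x]).det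

/-- Laplace expansion along the first two rows. Written out in this way, identities expressing
multilinearity and alternation become `ring` computations. -/
theorem det4_eq (u v w x : Fin 4 → ℂ) : det4 u v w x =
    (u 0 * v 1 - u 1 * v 0) * (w 2 * x 3 - w 3 * x 2)
      - (u 0 * v 2 - u 2 * v 0) * (w 1 * x 3 - w 3 * x 1)
      + (u 0 * v 3 - u 3 * v 0) * (w 1 * x 2 - w 2 * x 1)
      + (u 1 * v 2 - u 2 * v 1) * (w 0 * x 3 - w 3 * x 0)
      - (u 1 * v 3 - u 3 * v 1) * (w 0 * x 2 - w 2 * x 0)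
      + (u 2 * v 3 - u 3 * v 2) * (w 0 * x 1 - w 1 * x 0) := by
  have h1 : Fin.succAbove (1 : Fin 4) (2 : Fin 3) = 3 := rfl
  have h2 : Fin.succAbove (2 : Fin 4) (2 : Fin 3) = 3 := rfl
  have h3 : Fin.succAbove (3 : Fin 4) (2 : Fin 3) = 2 := rfl
  simp [det4, Matrix.det_succ_row_zero, Fin.sum_univ_succ, h1, h2, h3]
  ring

theorem det4_ne_zero_iff {u v w x : Fin 4 → ℂ} :
    det4 u v w x ≠ 0 ↔ LinearIndependent ℂ ![u, v, w, x] := by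
  rw [det4, ← isUnit_iff_ne_zero, ← Matrix.isUnit_iff_isUnit_det,
    ← Matrix.linearIndependent_rows_iff_isUnit]
  rfl

theorem det4_vecMul_second (v b c : Fin 4 → ℂ) (y : Fin 3 → ℂ) (A : Matrix (Fin 3) (Fin 4) ℂ) :
    det4 v (y ᵥ* A) b c = ∑ i, y i * det4 v (A i) b c := by
  simp only [det4_eq, Matrix.vecMul, dotProduct, Fin.sum_univ_three]
  ring

theorem det4_vecMul_third (v a c : Fin 4 → ℂ) (y : Fin 3 → ℂ) (A : Matrix (Fin 3) (Fin 4) ℂ) :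
    det4 v a (y ᵥ* A) c = ∑ i, y i * det4 v a (A i) c := by
  simp only [det4_eq, Matrix.vecMul, dotProduct, Fin.sum_univ_three]
  ring

theorem det4_vecMul_fourth (v a b : Fin 4 → ℂ) (y : Fin 3 → ℂ) (A : Matrix (Fin 3) (Fin 4) ℂ) :
    det4 v a b (y ᵥ* A) = ∑ i, y i * det4 v a b (A i) := by
  simp only [det4_eq, Matrix.vecMul, dotProduct, Fin.sum_univ_three]
  ring

/-- Otherwise `c`, `a`, `b` span a proper subspace of `ℂ⁴`, and any `v` outside it gives a nonzero
determinant. -/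
theorem mem_span_pair_of_det4_eq_zero {a b c : Fin 4 → ℂ} (hab : LinearIndependent ℂ ![a, b])
    (h : ∀ v, det4 v c a b = 0) : c ∈ Submodule.span ℂ {a, b} := by
  by_contra hc
  have hcab : LinearIndependent ℂ ![c, a, b] := by
    refine linearIndependent_finCons.2 ⟨hab, ?_⟩
    simpa [Set.pair_comm] using hc
  have hlt : finrank ℂ (Submodule.span ℂ (Set.range ![c, a, b])) < finrank ℂ (Fin 4 → ℂ) := by
    rw [finrank_span_eq_card hcab]
    simp
  obtain ⟨v, hv⟩ : ∃ v, v ∉ Submodule.span ℂ (Set.range ![c, a, b]) := by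
    by_contra! hall
    rw [(Submodule.eq_top_iff').2 hall, finrank_top] at hlt
    exact hlt.false
  exact det4_ne_zero_iff.2 (linearIndependent_finCons.2 ⟨hcab, hv⟩) (h v)

/-! ### Camera centers -/

/-- A vector that spans the kernel of a camera matrix of rank `3`. -/
noncomputable def centerVec (C : Matrix (Fin 3) (Fin 4) ℂ) : Fin 4 → ℂ :=
  fun k => det4 (C 0) (C 1) (C 2) (Pi.single k 1)

/-- The entries of `centerVec C` are the cofactors of a fourth row placed below `C`. Taking a row of
`C` for `h` repeats a row, so `centerVec C` lies in the kernel. -/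
theorem dotProduct_centerVec (C : Matrix (Fin 3) (Fin 4) ℂ) (h : Fin 4 → ℂ) :
    h ⬝ᵥ centerVec C = det4 (C 0) (C 1) (C 2) h := by
  simp [centerVec, dotProduct, Fin.sum_univ_four, det4_eq, Pi.single_apply]
  ring

theorem row_dotProduct_centerVec (C : Matrix (Fin 3) (Fin 4) ℂ) (r : Fin 3) :
    C r ⬝ᵥ centerVec C = 0 := by
  rw [dotProduct_centerVec]
  fin_cases r <;> simp [det4_eq] <;> ring

theorem mulVec_centerVec (C : Matrix (Fin 3) (Fin 4) ℂ) : C.mulVec (centerVec C) = 0 :=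
  funext fun r => row_dotProduct_centerVec C r

theorem vecMul_dotProduct_centerVec (C : Matrix (Fin 3) (Fin 4) ℂ) (y : Fin 3 → ℂ) :
    (y ᵥ* C) ⬝ᵥ centerVec C = 0 := by
  rw [← Matrix.dotProduct_mulVec, mulVec_centerVec, dotProduct_zero]

/-- A nonzero entry is the determinant of `C` bordered by a unit vector. The condition `centerVec C
≠ 0` serves as the polynomial form of rank 3. -/
theorem linearIndependent_rows_of_centerVec_ne_zero {C : Matrix (Fin 3) (Fin 4) ℂ}
    (h : centerVec C ≠ 0) : LinearIndependent ℂ C.row := by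
  obtain ⟨k, hk⟩ := Function.ne_iff.1 h
  have := (det4_ne_zero_iff.1 hk).comp (Fin.castSucc : Fin 3 → Fin 4) (Fin.castSucc_injective _)
  convert this using 1
  funext r
  fin_cases r <;> rfl

theorem rank_eq_three {C : Matrix (Fin 3) (Fin 4) ℂ} (h : centerVec C ≠ 0) : C.rank = 3 := by
  simpa using (linearIndependent_rows_of_centerVec_ne_zero h).rank_matrix

theorem vecMul_injective {C : Matrix (Fin 3) (Fin 4) ℂ} (h : centerVec C ≠ 0) :
    Function.Injective fun y : Fin 3 → ℂ => y ᵥ* C :=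
  Matrix.vecMul_injective_iff.2 (linearIndependent_rows_of_centerVec_ne_zero h)

theorem cameraCenter_eq_span {C : Matrix (Fin 3) (Fin 4) ℂ} (h : centerVec C ≠ 0) :
    cameraCenter C = Submodule.span ℂ {centerVec C} := by
  symm
  apply Submodule.eq_of_le_of_finrank_eq
  · rw [Submodule.span_singleton_le_iff_mem]
    exact mulVec_centerVec C
  · have h1 := C.mulVecLin.finrank_range_add_finrank_ker
    have h2 : finrank ℂ (LinearMap.range C.mulVecLin) = 3 := rank_eq_three h
    rw [h2, Module.finrank_fin_fun] at h1
    rw [finrank_span_singleton h, cameraCenter]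
    omega

theorem disjoint_cameraCenter {C : Matrix (Fin 3) (Fin 4) ℂ} (h : centerVec C ≠ 0)
    {L : Submodule ℂ (Fin 4 → ℂ)} (hL : centerVec C ∉ L) : Disjoint L (cameraCenter C) := by
  rw [cameraCenter_eq_span h, Submodule.disjoint_span_singleton' h]
  exact hL

/-! ### Lines in space and their images -/

/-- The line of `ℙ³` in which the planes with equations `a` and `b` intersect. -/
def lineOf (a b : Fin 4 → ℂ) : Submodule ℂ (Fin 4 → ℂ) :=
  LinearMap.ker (Matrix.of ![a, b]).mulVecLin

theorem mem_lineOf {a b v : Fin 4 → ℂ} : v ∈ lineOf a b ↔ a ⬝ᵥ v = 0 ∧ b ⬝ᵥ v = 0 := by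
  simp [lineOf, funext_iff, Fin.forall_fin_two]

theorem finrank_lineOf {a b : Fin 4 → ℂ} (h : LinearIndependent ℂ ![a, b]) :
    finrank ℂ (lineOf a b) = 2 := by
  have h1 := (Matrix.of ![a, b]).mulVecLin.finrank_range_add_finrank_ker
  have h2 : (Matrix.of ![a, b]).rank = 2 := by
    simpa using LinearIndependent.rank_matrix (M := Matrix.of ![a, b]) h
  rw [Matrix.rank] at h2
  rw [h2, Module.finrank_fin_fun] at h1
  rw [lineOf]
  omega

theorem dotProduct_eq_zero_of_mem_span_pair {a b c v : Fin 4 → ℂ}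
    (hc : c ∈ Submodule.span ℂ {a, b}) (hv : v ∈ lineOf a b) : c ⬝ᵥ v = 0 := by
  obtain ⟨x, y, rfl⟩ := Submodule.mem_span_pair.1 hc
  obtain ⟨h1, h2⟩ := mem_lineOf.1 hv
  simp [add_dotProduct, h1, h2]

theorem mem_imageLine {ℓ : PTwo} {x : Fin 3 → ℂ} : x ∈ imageLine ℓ ↔ ℓ.rep ⬝ᵥ x = 0 := Iff.rfl

theorem finrank_ker_dotProduct {y : Fin 3 → ℂ} (hy : y ≠ 0) :
    finrank ℂ (LinearMap.ker (dotProductBilin ℂ ℂ y)) = 2 := by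
  have h1 := (dotProductBilin ℂ ℂ y).finrank_range_add_finrank_ker
  have h2 : LinearMap.range (dotProductBilin ℂ ℂ y) = ⊤ := by
    refine LinearMap.range_eq_top.2 (LinearMap.surjective fun h0 => hy ?_)
    refine dotProduct_eq_zero_iff.1 fun w => ?_
    exact LinearMap.congr_fun h0 w
  rw [h2, finrank_top, Module.finrank_self, Module.finrank_fin_fun] at h1
  omega

theorem finrank_map_of_disjoint {C : Matrix (Fin 3) (Fin 4) ℂ} {L : Submodule ℂ (Fin 4 → ℂ)}
    (h : Disjoint L (cameraCenter C)) : finrank ℂ (L.map C.mulVecLin) = finrank ℂ L := by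
  rw [← LinearMap.range_domRestrict]
  refine LinearMap.finrank_range_of_inj (LinearMap.ker_eq_bot.1 ?_)
  rw [LinearMap.ker_domRestrict, ← Submodule.disjoint_iff_comap_eq_bot]
  exact h

theorem CameraMaps.vecMul_dotProduct {C : Matrix (Fin 3) (Fin 4) ℂ}
    {L : Submodule ℂ (Fin 4 → ℂ)} {ℓ : PTwo} (h : CameraMaps C L ℓ) {v : Fin 4 → ℂ} (hv : v ∈ L) :
    (ℓ.rep ᵥ* C) ⬝ᵥ v = 0 := by
  rw [← Matrix.dotProduct_mulVec, ← mem_imageLine, ← h.2]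
  exact Submodule.mem_map_of_mem (f := C.mulVecLin) hv

/-- The image lies in the line with equation `y`, and both are two-dimensional because `C` is
injective on `L`. -/
theorem map_eq_ker_dotProduct {C : Matrix (Fin 3) (Fin 4) ℂ} {L : Submodule ℂ (Fin 4 → ℂ)}
    (hL : finrank ℂ L = 2) (h : Disjoint L (cameraCenter C)) {y : Fin 3 → ℂ} (hy : y ≠ 0)
    (hLy : ∀ v ∈ L, (y ᵥ* C) ⬝ᵥ v = 0) :
    L.map C.mulVecLin = LinearMap.ker (dotProductBilin ℂ ℂ y) := by
  apply Submodule.eq_of_le_of_finrank_eq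
  · rintro _ ⟨v, hv, rfl⟩
    have := hLy v hv
    rwa [← Matrix.dotProduct_mulVec] at this
  · rw [finrank_map_of_disjoint h, finrank_ker_dotProduct hy, hL]

theorem cameraMaps_of_forall {C : Matrix (Fin 3) (Fin 4) ℂ} {L : Submodule ℂ (Fin 4 → ℂ)}
    (hL : finrank ℂ L = 2) (h : Disjoint L (cameraCenter C)) {ℓ : PTwo}
    (hLy : ∀ v ∈ L, (ℓ.rep ᵥ* C) ⬝ᵥ v = 0) : CameraMaps C L ℓ :=
  ⟨h, map_eq_ker_dotProduct hL h ℓ.rep_nonzero hLy⟩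

theorem exists_smul_eq_of_ker_le {y z : Fin 3 → ℂ}
    (h : LinearMap.ker (dotProductBilin ℂ ℂ y) ≤ LinearMap.ker (dotProductBilin ℂ ℂ z)) :
    ∃ c : ℂ, z = c • y := by
  have := mem_span_of_iInf_ker_le_ker (L := fun _ : Unit => dotProductBilin ℂ ℂ y)
    (K := dotProductBilin ℂ ℂ z) (by simpa using h)
  rw [Set.range_const, Submodule.mem_span_singleton] at this
  obtain ⟨c, hc⟩ := this
  refine ⟨c, ?_⟩
  rw [← sub_eq_zero, ← dotProduct_eq_zero_iff]
  intro w
  have := LinearMap.congr_fun hc w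
  simp only [LinearMap.smul_apply, dotProductBilin_apply_apply] at this
  rw [sub_dotProduct, smul_dotProduct, this, sub_self]

/-- The equation of the image line is determined up to a factor. -/
theorem CameraMaps.exists_rep_eq_smul {C : Matrix (Fin 3) (Fin 4) ℂ}
    {L : Submodule ℂ (Fin 4 → ℂ)} {ℓ : PTwo} (h : CameraMaps C L ℓ) (hL : finrank ℂ L = 2)
    {y : Fin 3 → ℂ} (hy : y ≠ 0) (hLy : ∀ v ∈ L, (y ᵥ* C) ⬝ᵥ v = 0) :
    ∃ c : ℂ, ℓ.rep = c • y := by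
  have h1 := map_eq_ker_dotProduct hL h.1 hy hLy
  rw [h.2] at h1
  exact exists_smul_eq_of_ker_le h1.symm.le

theorem PTwo.ext_of_rep_eq_smul {ℓ ℓ' : PTwo} {c : ℂ} (h : ℓ.rep = c • ℓ'.rep) : ℓ = ℓ' := by
  rw [← ℓ.mk_rep, ← ℓ'.mk_rep, Projectivization.mk_eq_mk_iff']
  exact ⟨c, h.symm⟩

theorem CameraMaps.unique {C : Matrix (Fin 3) (Fin 4) ℂ} {L : Submodule ℂ (Fin 4 → ℂ)}
    {ℓ ℓ' : PTwo} (h : CameraMaps C L ℓ) (h' : CameraMaps C L ℓ') : ℓ = ℓ' := by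
  obtain ⟨c, hc⟩ := exists_smul_eq_of_ker_le (h'.2.symm.trans h.2).le
  exact PTwo.ext_of_rep_eq_smul hc

theorem exists_cameraMaps {C : Matrix (Fin 3) (Fin 4) ℂ} {L : Submodule ℂ (Fin 4 → ℂ)}
    (hL : finrank ℂ L = 2) (h : Disjoint L (cameraCenter C)) : ∃ ℓ : PTwo, CameraMaps C L ℓ := by
  have hlt : L.map C.mulVecLin < ⊤ := by
    refine lt_top_iff_ne_top.2 fun h0 => ?_
    have := finrank_map_of_disjoint h
    rw [h0, finrank_top, Module.finrank_fin_fun, hL] at this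
    omega
  -- The image is a proper subspace, so a nonzero functional kills it; its coordinate vector is the
  -- equation of the image line.
  obtain ⟨f, hf, hle⟩ := Submodule.exists_le_ker_of_lt_top _ hlt
  let y : Fin 3 → ℂ := fun i => f (Pi.single i 1)
  have hfy (x : Fin 3 → ℂ) : f x = y ⬝ᵥ x := by
    conv_lhs => rw [pi_eq_sum_univ' x, map_sum]
    refine Finset.sum_congr rfl fun i _ => ?_
    rw [map_smul, smul_eq_mul, mul_comm]
  have hy : y ≠ 0 := by
    intro h0
    exact hf (LinearMap.ext fun x => by rw [hfy, h0, zero_dotProduct]; rfl)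
  refine ⟨Projectivization.mk ℂ y hy, cameraMaps_of_forall hL h fun v hv => ?_⟩
  obtain ⟨c, hc⟩ := Projectivization.exists_smul_eq_mk_rep ℂ y hy
  have h0 : y ⬝ᵥ C.mulVec v = 0 := by
    rw [← hfy]
    exact hle (Submodule.mem_map_of_mem (f := C.mulVecLin) hv)
  rw [← hc, ← Matrix.dotProduct_mulVec, smul_dotProduct, h0, smul_zero]

/-! ### Points of the line multiview variety -/

section LineMultiview

variable {m : ℕ} {C : Fin m → Matrix (Fin 3) (Fin 4) ℂ}

/-- The equations of the back-projected planes of three views are linearly dependent. -/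
theorem det4_eq_zero_of_mem_lineMultiviewVariety {ℓ : Fin m → PTwo}
    (h : ℓ ∈ lineMultiviewVariety C) (i j k : Fin m) (v : Fin 4 → ℂ) :
    det4 v ((ℓ i).rep ᵥ* C i) ((ℓ j).rep ᵥ* C j) ((ℓ k).rep ᵥ* C k) = 0 := by
  -- The determinant expanded in the coordinates of the three views. It is trilinear, and the
  -- multidegrees add up correctly even if some of `i`, `j`, `k` coincide.
  let p : MvPolynomial (Fin m × Fin 3) ℂ := ∑ x : Fin 3, ∑ y : Fin 3, ∑ z : Fin 3,
    MvPolynomial.C (det4 v (C i x) (C j y) (C k z)) *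
      (MvPolynomial.X (i, x) * MvPolynomial.X (j, y) * MvPolynomial.X (k, z))
  have hp (ℓ : Fin m → PTwo) : MvPolynomial.eval (fun v : Fin m × Fin 3 => (ℓ v.1).rep v.2) p =
      det4 v ((ℓ i).rep ᵥ* C i) ((ℓ j).rep ᵥ* C j) ((ℓ k).rep ᵥ* C k) := by
    simp_rw [det4_vecMul_second, det4_vecMul_third, det4_vecMul_fourth, Finset.mul_sum]
    simp only [p, map_sum, map_mul, MvPolynomial.eval_C, MvPolynomial.eval_X]
    refine Finset.sum_congr rfl fun x _ => Finset.sum_congr rfl fun y _ =>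
      Finset.sum_congr rfl fun z _ => ?_
    ring
  have hhom : IsMultihomogeneous p := by
    refine ⟨Pi.single i 1 + Pi.single j 1 + Pi.single k 1,
      .sum _ _ _ fun x _ => .sum _ _ _ fun y _ => .sum _ _ _ fun z _ => ?_⟩
    have := (MvPolynomial.isWeightedHomogeneous_C (R := ℂ)
      (fun v : Fin m × Fin 3 => (Pi.single v.1 1 : Fin m → ℕ))
      (det4 v (C i x) (C j y) (C k z))).mul
      (((MvPolynomial.isWeightedHomogeneous_X ℂ _ (i, x)).mul
        (MvPolynomial.isWeightedHomogeneous_X ℂ _ (j, y))).mul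
        (MvPolynomial.isWeightedHomogeneous_X ℂ _ (k, z)))
    rwa [zero_add] at this
  have := h p hhom fun ℓ' ⟨L, hL, hmap⟩ => ?_
  · rwa [VanishesAt, hp] at this
  · rw [VanishesAt, hp]
    -- On an actual image the three planes contain the two-dimensional `L`, whereas independent
    -- planes would meet in a one-dimensional subspace.
    by_contra hne
    have hli := (linearIndependent_finCons.1 (det4_ne_zero_iff.1 hne)).1
    let M := Matrix.of ![(ℓ' i).rep ᵥ* C i, (ℓ' j).rep ᵥ* C j, (ℓ' k).rep ᵥ* C k]
    have h1 := M.mulVecLin.finrank_range_add_finrank_ker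
    have h2 : M.rank = 3 := by simpa using LinearIndependent.rank_matrix (M := M) hli
    rw [Matrix.rank] at h2
    rw [h2, Module.finrank_fin_fun] at h1
    have hle : L ≤ LinearMap.ker M.mulVecLin := fun x hx => by
      simp [M, funext_iff, Fin.forall_fin_succ, (hmap _).vecMul_dotProduct hx]
    have := Submodule.finrank_mono hle
    omega

theorem mem_lineMultiviewVariety_of_cameraMaps {ℓ : Fin m → PTwo} {L : Submodule ℂ (Fin 4 → ℂ)}
    (hL : finrank ℂ L = 2) (h : ∀ n, CameraMaps (C n) L (ℓ n)) : ℓ ∈ lineMultiviewVariety C :=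
  fun _ _ hp => hp ℓ ⟨L, hL, h⟩

/-- A line that meets no camera center has an image. -/
theorem exists_forall_cameraMaps (hC : ∀ n, centerVec (C n) ≠ 0) {a b : Fin 4 → ℂ}
    (hab : LinearIndependent ℂ ![a, b]) (hc : ∀ n, centerVec (C n) ∉ lineOf a b) :
    ∃ ℓ ∈ lineMultiviewVariety C, ∀ n, CameraMaps (C n) (lineOf a b) (ℓ n) := by
  choose ℓ hℓ using fun n => exists_cameraMaps (finrank_lineOf hab)
    (disjoint_cameraCenter (hC n) (hc n))
  exact ⟨ℓ, mem_lineMultiviewVariety_of_cameraMaps (finrank_lineOf hab) hℓ, hℓ⟩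

theorem lineOf_eq_of_mem_span {a b a' b' : Fin 4 → ℂ} (hab : LinearIndependent ℂ ![a, b])
    (hab' : LinearIndependent ℂ ![a', b']) (ha : a' ∈ Submodule.span ℂ {a, b})
    (hb : b' ∈ Submodule.span ℂ {a, b}) : lineOf a' b' = lineOf a b := by
  symm
  apply Submodule.eq_of_le_of_finrank_eq
  · exact fun v hv => mem_lineOf.2 ⟨dotProduct_eq_zero_of_mem_span_pair ha hv,
      dotProduct_eq_zero_of_mem_span_pair hb hv⟩
  · rw [finrank_lineOf hab, finrank_lineOf hab']

/-- Dependence of triples says that all back-projected planes belong to the pencil determined by any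
two distinct ones. -/
theorem mem_span_of_mem_lineMultiviewVariety {ℓ : Fin m → PTwo} (h : ℓ ∈ lineMultiviewVariety C)
    {i j : Fin m} (hij : LinearIndependent ℂ ![(ℓ i).rep ᵥ* C i, (ℓ j).rep ᵥ* C j]) (n : Fin m) :
    (ℓ n).rep ᵥ* C n ∈ Submodule.span ℂ {(ℓ i).rep ᵥ* C i, (ℓ j).rep ᵥ* C j} :=
  mem_span_pair_of_det4_eq_zero hij fun v => det4_eq_zero_of_mem_lineMultiviewVariety h n i j v

/-- A point of the line multiview variety is the image of the line in which two of the
back-projected planes intersect, if this line meets no camera center. -/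
theorem cameraMaps_of_mem_lineMultiviewVariety (hC : ∀ n, centerVec (C n) ≠ 0)
    {ℓ : Fin m → PTwo} (h : ℓ ∈ lineMultiviewVariety C) {i j : Fin m}
    (hij : LinearIndependent ℂ ![(ℓ i).rep ᵥ* C i, (ℓ j).rep ᵥ* C j])
    (hc : ∀ n, centerVec (C n) ∉ lineOf ((ℓ i).rep ᵥ* C i) ((ℓ j).rep ᵥ* C j)) (n : Fin m) :
    CameraMaps (C n) (lineOf ((ℓ i).rep ᵥ* C i) ((ℓ j).rep ᵥ* C j)) (ℓ n) :=
  cameraMaps_of_forall (finrank_lineOf hij) (disjoint_cameraCenter (hC n) (hc n)) fun _ hv =>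
    dotProduct_eq_zero_of_mem_span_pair (mem_span_of_mem_lineMultiviewVariety h hij n) hv

end LineMultiview

/-! ### Planes, pencils and incidence -/

/-- One plane passes through the point `c` and the other does not, so they differ. In the
applications `c` is a camera center. -/
theorem linearIndependent_pair_of_dotProduct {g w c : Fin 4 → ℂ} (hg : g ≠ 0) (hgc : g ⬝ᵥ c = 0)
    (hwc : w ⬝ᵥ c ≠ 0) : LinearIndependent ℂ ![g, w] := by
  rw [LinearIndependent.pair_iff]
  intro s t h
  have h1 : t * (w ⬝ᵥ c) = 0 := by
    simpa [add_dotProduct, hgc] using congrArg (· ⬝ᵥ c) h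
  have ht : t = 0 := by simpa [hwc] using h1
  subst ht
  simpa [hg] using h

theorem eq_zero_of_det4_ne_zero {u v w x : Fin 4 → ℂ} (h : det4 u v w x ≠ 0) {a b c d : ℂ}
    (h0 : a • u + b • v + c • w + d • x = 0) : a = 0 ∧ b = 0 ∧ c = 0 ∧ d = 0 := by
  have := Fintype.linearIndependent_iff.1 (det4_ne_zero_iff.1 h) ![a, b, c, d]
    (by simpa [Fin.sum_univ_four] using h0)
  exact ⟨this 0, this 1, this 2, this 3⟩

/-- Cramer's rule. -/
theorem det4_smul_eq (a b c d w : Fin 4 → ℂ) : det4 a b c d • w =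
    det4 w b c d • a + det4 a w c d • b + det4 a b w d • c + det4 a b c w • d := by
  funext k
  fin_cases k <;> simp [det4_eq] <;> ring

theorem exists_eq_of_det4_eq_zero {a b c d w : Fin 4 → ℂ} (h : det4 a b c d ≠ 0)
    (hw : det4 a b c w = 0) : ∃ x y z : ℂ, w = x • a + y • b + z • c := by
  have := det4_smul_eq a b c d w
  rw [hw, zero_smul, add_zero] at this
  refine ⟨(det4 a b c d)⁻¹ * det4 w b c d, (det4 a b c d)⁻¹ * det4 a w c d,
    (det4 a b c d)⁻¹ * det4 a b w d, ?_⟩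
  rw [mul_smul, mul_smul, mul_smul, ← smul_add, ← smul_add, ← this, smul_smul,
    inv_mul_cancel₀ h, one_smul]

theorem det4_eq_zero_of_mem_span_pair {a b u v w : Fin 4 → ℂ} (x : Fin 4 → ℂ)
    (hu : u ∈ Submodule.span ℂ {a, b}) (hv : v ∈ Submodule.span ℂ {a, b})
    (hw : w ∈ Submodule.span ℂ {a, b}) : det4 u v w x = 0 := by
  obtain ⟨u₁, u₂, rfl⟩ := Submodule.mem_span_pair.1 hu
  obtain ⟨v₁, v₂, rfl⟩ := Submodule.mem_span_pair.1 hv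
  obtain ⟨w₁, w₂, rfl⟩ := Submodule.mem_span_pair.1 hw
  simp only [det4_eq, Pi.add_apply, Pi.smul_apply, smul_eq_mul]
  ring

/-- The vanishing determinant says that the lines `a ∩ b` and `e ∩ f` meet; then some plane of the
pencil of `e` and `f` contains the line `a ∩ b`. Independence of `a`, `b` keeps its coefficients
from both vanishing. -/
theorem exists_mem_span_of_det4_eq_zero {a b e f : Fin 4 → ℂ} (hab : LinearIndependent ℂ ![a, b])
    (h : det4 a b e f = 0) :
    ∃ u v : ℂ, (u ≠ 0 ∨ v ≠ 0) ∧ u • e + v • f ∈ Submodule.span ℂ {a, b} := by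
  have h' : ¬ LinearIndependent ℂ ![a, b, e, f] := fun hli => det4_ne_zero_iff.2 hli h
  rw [Fintype.not_linearIndependent_iff] at h'
  obtain ⟨g, hg, i, hi⟩ := h'
  simp only [Fin.sum_univ_four, Matrix.cons_val] at hg
  have hmem : g 2 • e + g 3 • f = (-g 0) • a + (-g 1) • b := by
    rw [← sub_eq_zero, ← hg]
    module
  refine ⟨g 2, g 3, ?_, Submodule.mem_span_pair.2 ⟨_, _, hmem.symm⟩⟩
  by_contra! h0
  rw [h0.1, h0.2, zero_smul, zero_smul, add_zero] at hmem
  obtain ⟨h1, h2⟩ := LinearIndependent.pair_iff.1 hab _ _ hmem.symm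
  rw [neg_eq_zero] at h1 h2
  fin_cases i
  exacts [hi h1, hi h2, hi h0.1, hi h0.2]

theorem det4_eq_zero_of_smul_add_smul_mem_span {a b e f : Fin 4 → ℂ} {u v : ℂ}
    (huv : u ≠ 0 ∨ v ≠ 0) (h : u • e + v • f ∈ Submodule.span ℂ {a, b}) : det4 a b e f = 0 := by
  obtain ⟨x, y, hxy⟩ := Submodule.mem_span_pair.1 h
  have hu : u * det4 a b e f = det4 a b (u • e + v • f) f := by
    simp only [det4_eq, Pi.add_apply, Pi.smul_apply, smul_eq_mul]
    ring
  have hv : v * det4 a b e f = det4 a b e (u • e + v • f) := by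
    simp only [det4_eq, Pi.add_apply, Pi.smul_apply, smul_eq_mul]
    ring
  have hu' : det4 a b (x • a + y • b) f = 0 := by
    simp only [det4_eq, Pi.add_apply, Pi.smul_apply, smul_eq_mul]
    ring
  have hv' : det4 a b e (x • a + y • b) = 0 := by
    simp only [det4_eq, Pi.add_apply, Pi.smul_apply, smul_eq_mul]
    ring
  rw [← hxy, hu'] at hu
  rw [← hxy, hv'] at hv
  rcases huv with h0 | h0
  · simpa [h0] using hu
  · simpa [h0] using hv

/-- The plane of the pencil spanned by `e` and `f` that passes through the point `c`. -/
def planeThrough (e f c : Fin 4 → ℂ) : Fin 4 → ℂ := (f ⬝ᵥ c) • e - (e ⬝ᵥ c) • f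

/-- The equation for `s` and `t` makes `planeThrough e f c` a multiple of `s • e + t • f`. The
factor is zero when `c` lies on the axis of the pencil. -/
theorem planeThrough_mem {e f c : Fin 4 → ℂ} {s t : ℂ} (hst : s ≠ 0 ∨ t ≠ 0)
    (h : (s • e + t • f) ⬝ᵥ c = 0) {W : Submodule ℂ (Fin 4 → ℂ)} (hW : s • e + t • f ∈ W) :
    planeThrough e f c ∈ W := by
  rw [add_dotProduct, smul_dotProduct, smul_dotProduct, smul_eq_mul, smul_eq_mul] at h
  rcases hst with h0 | h0
  · convert W.smul_mem ((f ⬝ᵥ c) / s) hW using 1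
    rw [planeThrough, smul_add, smul_smul, smul_smul, div_mul_cancel₀ _ h0, sub_eq_add_neg,
      ← neg_smul]
    congr 2
    field_simp
    linear_combination -h
  · convert W.smul_mem (-(e ⬝ᵥ c) / t) hW using 1
    rw [planeThrough, smul_add, smul_smul, smul_smul, div_mul_cancel₀ _ h0, sub_eq_add_neg,
      ← neg_smul]
    congr 2
    field_simp
    linear_combination h

/-- A line that meets three general lines does not pass through a general point. -/
theorem notMem_lineOf {a b c v : Fin 4 → ℂ} {e f : Fin 3 → Fin 4 → ℂ} {s t : Fin 3 → ℂ}
    (hst : ∀ x, s x ≠ 0 ∨ t x ≠ 0) (hmem : ∀ x, s x • e x + t x • f x ∈ Submodule.span ℂ {a, b})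
    (h : det4 (planeThrough (e 0) (f 0) c) (planeThrough (e 1) (f 1) c)
      (planeThrough (e 2) (f 2) c) v ≠ 0) : c ∉ lineOf a b := fun hc =>
  have key x := planeThrough_mem (hst x) (dotProduct_eq_zero_of_mem_span_pair (hmem x) hc) (hmem x)
  h (det4_eq_zero_of_mem_span_pair v (key 0) (key 1) (key 2))

/-- Together with `pencilBasis₂`, a basis of the space of vectors orthogonal to `α`, if
`α 0 ≠ 0`. -/
def pencilBasis₁ (α : Fin 3 → ℂ) : Fin 3 → ℂ := ![-α 1, α 0, 0]

/-- Together with `pencilBasis₁`, a basis of the space of vectors orthogonal to `α`, if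
`α 0 ≠ 0`. -/
def pencilBasis₂ (α : Fin 3 → ℂ) : Fin 3 → ℂ := ![-α 2, 0, α 0]

/-- A vector orthogonal to `α`. -/
def pencilVec (α : Fin 3 → ℂ) (s t : ℂ) : Fin 3 → ℂ := s • pencilBasis₁ α + t • pencilBasis₂ α

theorem dotProduct_pencilVec (α : Fin 3 → ℂ) (s t : ℂ) : α ⬝ᵥ pencilVec α s t = 0 := by
  simp [pencilVec, pencilBasis₁, pencilBasis₂, dotProduct, Fin.sum_univ_three]
  ring

theorem pencilVec_ne_zero {α : Fin 3 → ℂ} (hα : α 0 ≠ 0) {s t : ℂ} (h : s ≠ 0 ∨ t ≠ 0) :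
    pencilVec α s t ≠ 0 := by
  intro h0
  have h1 : s = 0 := by
    simpa [pencilVec, pencilBasis₁, pencilBasis₂, hα] using congrFun h0 1
  have h2 : t = 0 := by
    simpa [pencilVec, pencilBasis₁, pencilBasis₂, hα] using congrFun h0 2
  simp [h1, h2] at h

theorem smul_pencilVec (α : Fin 3 → ℂ) (c s t : ℂ) :
    c • pencilVec α s t = pencilVec α (c * s) (c * t) := by
  rw [pencilVec, pencilVec, smul_add, smul_smul, smul_smul]

theorem pencilVec_injective {α : Fin 3 → ℂ} (hα : α 0 ≠ 0) {s t s' t' : ℂ}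
    (h : pencilVec α s t = pencilVec α s' t') : s = s' ∧ t = t' := by
  have h1 := congrFun h 1
  have h2 := congrFun h 2
  simp only [pencilVec, pencilBasis₁, pencilBasis₂] at h1 h2
  exact ⟨by simpa [hα] using h1, by simpa [hα] using h2⟩

theorem exists_eq_pencilVec {α y : Fin 3 → ℂ} (hα : α 0 ≠ 0) (hy : y ≠ 0) (h : α ⬝ᵥ y = 0) :
    ∃ s t : ℂ, (s ≠ 0 ∨ t ≠ 0) ∧ y = pencilVec α s t := by
  simp only [dotProduct, Fin.sum_univ_three] at h
  have key : y = pencilVec α (y 1 / α 0) (y 2 / α 0) := by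
    funext k
    fin_cases k <;> simp [pencilVec, pencilBasis₁, pencilBasis₂] <;> field_simp
    linear_combination h
  refine ⟨_, _, ?_, key⟩
  by_contra! h0
  rw [h0.1, h0.2] at key
  exact hy (by simpa [pencilVec] using key)

/-- The first basis vector of the pencil of planes that are the back-projections of lines through
the image point `α`. -/
def backPencil₁ (C : Matrix (Fin 3) (Fin 4) ℂ) (α : Fin 3 → ℂ) : Fin 4 → ℂ := pencilBasis₁ α ᵥ* C

/-- The second basis vector of the pencil of planes that are the back-projections of lines through
the image point `α`. -/
def backPencil₂ (C : Matrix (Fin 3) (Fin 4) ℂ) (α : Fin 3 → ℂ) : Fin 4 → ℂ := pencilBasis₂ α ᵥ* C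

theorem pencilVec_vecMul (C : Matrix (Fin 3) (Fin 4) ℂ) (α : Fin 3 → ℂ) (s t : ℂ) :
    pencilVec α s t ᵥ* C = s • backPencil₁ C α + t • backPencil₂ C α := by
  rw [pencilVec, Matrix.add_vecMul, Matrix.smul_vecMul, Matrix.smul_vecMul, backPencil₁,
    backPencil₂]

/-- By the triple product identity, `(α × β) × y = (α · y) β - (β · y) α = 0`. -/
theorem exists_eq_smul_cross {α β y : Fin 3 → ℂ} (h : crossProduct α β ≠ 0) (hα : α ⬝ᵥ y = 0)
    (hβ : β ⬝ᵥ y = 0) : ∃ c : ℂ, y = c • crossProduct α β := by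
  have h0 : crossProduct (crossProduct α β) y = 0 := by
    simp only [dotProduct, Fin.sum_univ_three] at hα hβ
    funext k
    fin_cases k <;> simp [cross_apply]
    · linear_combination β 0 * hα - α 0 * hβ
    · linear_combination β 1 * hα - α 1 * hβ
    · linear_combination β 2 * hα - α 2 * hβ
  have h1 := mt crossProduct_ne_zero_iff_linearIndependent.2 (not_not.2 h0)
  rw [LinearIndependent.pair_iff' h] at h1
  push Not at h1
  obtain ⟨c, hc⟩ := h1
  exact ⟨c, hc.symm⟩

theorem CameraMaps.dotProduct_rep {C : Matrix (Fin 3) (Fin 4) ℂ} {a b : Fin 4 → ℂ} {ℓ : PTwo}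
    (h : CameraMaps C (lineOf a b) ℓ) (hab : LinearIndependent ℂ ![a, b]) {y : Fin 3 → ℂ}
    (hy : y ≠ 0) (hmem : y ᵥ* C ∈ Submodule.span ℂ {a, b}) {α : Fin 3 → ℂ} (hα : α ⬝ᵥ y = 0) :
    α ⬝ᵥ ℓ.rep = 0 := by
  obtain ⟨c, hc⟩ := h.exists_rep_eq_smul (finrank_lineOf hab) hy fun v hv =>
    dotProduct_eq_zero_of_mem_span_pair hmem hv
  rw [hc, dotProduct_smul, hα, smul_zero]

/-- The uniqueness half of all three counts: two independent planes in the pencil of `a` and `b`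
already determine the line, and with it every view. -/
theorem eq_of_cameraMaps {m : ℕ} {C : Fin m → Matrix (Fin 3) (Fin 4) ℂ}
    (hC : ∀ n, centerVec (C n) ≠ 0) {a b : Fin 4 → ℂ}
    (hab : LinearIndependent ℂ ![a, b]) (hc : ∀ n, centerVec (C n) ∉ lineOf a b)
    {ℓ ℓ' : Fin m → PTwo} (hℓ : ∀ n, CameraMaps (C n) (lineOf a b) (ℓ n))
    (hℓ' : ℓ' ∈ lineMultiviewVariety C) {i j : Fin m}
    (hij : LinearIndependent ℂ ![(ℓ' i).rep ᵥ* C i, (ℓ' j).rep ᵥ* C j])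
    (hi : (ℓ' i).rep ᵥ* C i ∈ Submodule.span ℂ {a, b})
    (hj : (ℓ' j).rep ᵥ* C j ∈ Submodule.span ℂ {a, b}) : ℓ' = ℓ := by
  have heq := lineOf_eq_of_mem_span hab hij hi hj
  funext n
  have := cameraMaps_of_mem_lineMultiviewVariety hC hℓ' hij (by rwa [heq]) n
  rw [heq] at this
  exact this.unique (hℓ n)

/-! ### Sections with exactly one point -/

section Sections

variable {m : ℕ} {C : Fin m → Matrix (Fin 3) (Fin 4) ℂ}

/-- Two forms fix the line in a view as their cross product, so views `i` and `j` give two fixed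
planes, and the line sought is their intersection. -/
theorem exists_eq_singleton_of_two_points (hC : ∀ n, centerVec (C n) ≠ 0) {i j : Fin m}
    {α α' β β' : Fin 3 → ℂ}
    (hi : ∀ n, n ≠ i → (crossProduct α α' ᵥ* C i) ⬝ᵥ centerVec (C n) ≠ 0)
    (hj : ∀ n, n ≠ j → (crossProduct β β' ᵥ* C j) ⬝ᵥ centerVec (C n) ≠ 0) (hij : i ≠ j) :
    ∃ ℓ, lineMultiviewVariety C ∩ {ℓ | α ⬝ᵥ (ℓ i).rep = 0 ∧ α' ⬝ᵥ (ℓ i).rep = 0 ∧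
      β ⬝ᵥ (ℓ j).rep = 0 ∧ β' ⬝ᵥ (ℓ j).rep = 0} = {ℓ} := by
  have hgi : crossProduct α α' ᵥ* C i ≠ 0 := fun h0 => hi j hij.symm (by simp [h0])
  have hgj : crossProduct β β' ᵥ* C j ≠ 0 := fun h0 => hj i hij (by simp [h0])
  have hyi : crossProduct α α' ≠ 0 := fun h0 => hgi (by simp [h0])
  have hyj : crossProduct β β' ≠ 0 := fun h0 => hgj (by simp [h0])
  have hab := linearIndependent_pair_of_dotProduct hgi (vecMul_dotProduct_centerVec _ _) (hj i hij)
  -- The center of camera `i` is off the plane of view `j`; every other center is off the plane of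
  -- view `i`.
  have hc (n : Fin m) : centerVec (C n) ∉
      lineOf (crossProduct α α' ᵥ* C i) (crossProduct β β' ᵥ* C j) := fun hmem => by
    rw [mem_lineOf] at hmem
    by_cases hn : n = i
    · subst hn
      exact hj n hij hmem.2
    · exact hi n hn hmem.1
  obtain ⟨ℓ, hℓ, hmaps⟩ := exists_forall_cameraMaps hC hab hc
  refine ⟨ℓ, Set.eq_singleton_iff_unique_mem.2 ⟨⟨hℓ, ?_, ?_, ?_, ?_⟩, ?_⟩⟩
  · exact (hmaps i).dotProduct_rep hab hyi (Submodule.subset_span (by simp)) (dot_self_cross _ _)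
  · exact (hmaps i).dotProduct_rep hab hyi (Submodule.subset_span (by simp)) (dot_cross_self _ _)
  · exact (hmaps j).dotProduct_rep hab hyj (Submodule.subset_span (by simp)) (dot_self_cross _ _)
  · exact (hmaps j).dotProduct_rep hab hyj (Submodule.subset_span (by simp)) (dot_cross_self _ _)
  · rintro ℓ' ⟨hℓ', h1, h2, h3, h4⟩
    obtain ⟨c, hci⟩ := exists_eq_smul_cross hyi h1 h2
    obtain ⟨d, hdj⟩ := exists_eq_smul_cross hyj h3 h4
    have hc0 : c ≠ 0 := fun h0 => (ℓ' i).rep_nonzero (by rw [hci, h0, zero_smul])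
    have hd0 : d ≠ 0 := fun h0 => (ℓ' j).rep_nonzero (by rw [hdj, h0, zero_smul])
    have hI : (ℓ' i).rep ᵥ* C i = c • crossProduct α α' ᵥ* C i := by
      rw [hci, Matrix.smul_vecMul]
    have hJ : (ℓ' j).rep ᵥ* C j = d • crossProduct β β' ᵥ* C j := by
      rw [hdj, Matrix.smul_vecMul]
    refine eq_of_cameraMaps hC hab hc hmaps hℓ' (i := i) (j := j) ?_ ?_ ?_
    · refine linearIndependent_pair_of_dotProduct (c := centerVec (C i)) ?_
        (vecMul_dotProduct_centerVec _ _) ?_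
      · rw [hI]
        exact smul_ne_zero hc0 hgi
      · rw [hJ, smul_dotProduct]
        exact smul_ne_zero hd0 (hj i hij)
    · rw [hI]
      exact Submodule.smul_mem _ _ (Submodule.subset_span (by simp))
    · rw [hJ]
      exact Submodule.smul_mem _ _ (Submodule.subset_span (by simp))

/-- The plane of the pencil spanned by `e` and `f` that passes through the intersection point of
the planes `g`, `e'`, `f'`. -/
noncomputable def joinPlane (g e' f' e f : Fin 4 → ℂ) : Fin 4 → ℂ :=
  det4 g e' f' f • e - det4 g e' f' e • f

/-- The line lies in the plane `g` fixed by view `i` and passes through the point where `g` meets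
the ray of view `j`. The plane of the pencil of view `k` through this point is `w`, so the line is
`g ∩ w`. -/
theorem exists_eq_singleton_of_point_of_two_lines (hC : ∀ n, centerVec (C n) ≠ 0) {i j k : Fin m}
    {α α' β γ : Fin 3 → ℂ} (hβ : β 0 ≠ 0) (hγ : γ 0 ≠ 0)
    (hi : ∀ n, n ≠ i → (crossProduct α α' ᵥ* C i) ⬝ᵥ centerVec (C n) ≠ 0)
    (hdet : det4 (crossProduct α α' ᵥ* C i) (backPencil₁ (C j) β) (backPencil₂ (C j) β)
      (backPencil₁ (C k) γ) ≠ 0)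
    (hw : joinPlane (crossProduct α α' ᵥ* C i) (backPencil₁ (C j) β) (backPencil₂ (C j) β)
      (backPencil₁ (C k) γ) (backPencil₂ (C k) γ) ⬝ᵥ centerVec (C i) ≠ 0) :
    ∃ ℓ, lineMultiviewVariety C ∩ {ℓ | α ⬝ᵥ (ℓ i).rep = 0 ∧ α' ⬝ᵥ (ℓ i).rep = 0 ∧
      β ⬝ᵥ (ℓ j).rep = 0 ∧ γ ⬝ᵥ (ℓ k).rep = 0} = {ℓ} := by
  set g := crossProduct α α' ᵥ* C i with hg
  set e := backPencil₁ (C j) β with he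
  set f := backPencil₂ (C j) β with hf
  set e' := backPencil₁ (C k) γ with he'
  set f' := backPencil₂ (C k) γ with hf'
  set w := joinPlane g e f e' f' with hwdef
  have hg0 : g ≠ 0 := fun h0 => hdet (by simp [det4_eq, h0])
  have hyi : crossProduct α α' ≠ 0 := fun h0 => hg0 (by simp [hg, h0])
  have hgc : g ⬝ᵥ centerVec (C i) = 0 := vecMul_dotProduct_centerVec _ _
  have hab := linearIndependent_pair_of_dotProduct hg0 hgc hw
  have hc (n : Fin m) : centerVec (C n) ∉ lineOf g w := fun hmem => by
    rw [mem_lineOf] at hmem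
    by_cases hn : n = i
    · subst hn
      exact hw hmem.2
    · exact hi n hn hmem.1
  have hwk : w = pencilVec γ (det4 g e f f') (-det4 g e f e') ᵥ* C k := by
    rw [pencilVec_vecMul, hwdef, joinPlane, neg_smul, sub_eq_add_neg]
  -- Since `w` passes through the point `g ∩ e ∩ f`, it is a combination of these three planes. Its
  -- part `y • e + z • f` is the back-projected plane of view `j`, and is nontrivial because `w`,
  -- unlike `g`, avoids the center of camera `i`.
  obtain ⟨x, y, z, hxyz⟩ : ∃ x y z : ℂ, w = x • g + y • e + z • f := by
    refine exists_eq_of_det4_eq_zero hdet ?_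
    simp only [hwdef, joinPlane, det4_eq, Pi.sub_apply, Pi.smul_apply, smul_eq_mul]
    ring
  have hyz : y ≠ 0 ∨ z ≠ 0 := by
    by_contra! h0
    refine hw ?_
    rw [hxyz, h0.1, h0.2, zero_smul, zero_smul, add_zero, add_zero, smul_dotProduct, hgc,
      smul_zero]
  have hj : pencilVec β y z ᵥ* C j ∈ Submodule.span ℂ {g, w} := by
    rw [pencilVec_vecMul, Submodule.mem_span_pair]
    refine ⟨-x, 1, ?_⟩
    rw [hxyz]
    module
  obtain ⟨ℓ, hℓ, hmaps⟩ := exists_forall_cameraMaps hC hab hc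
  refine ⟨ℓ, Set.eq_singleton_iff_unique_mem.2 ⟨⟨hℓ, ?_, ?_, ?_, ?_⟩, ?_⟩⟩
  · exact (hmaps i).dotProduct_rep hab hyi (Submodule.subset_span (by simp [hg]))
      (dot_self_cross _ _)
  · exact (hmaps i).dotProduct_rep hab hyi (Submodule.subset_span (by simp [hg]))
      (dot_cross_self _ _)
  · exact (hmaps j).dotProduct_rep hab (pencilVec_ne_zero hβ hyz) hj (dotProduct_pencilVec _ _ _)
  · refine (hmaps k).dotProduct_rep hab (pencilVec_ne_zero hγ (Or.inr (neg_ne_zero.2 hdet))) ?_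
      (dotProduct_pencilVec γ (det4 g e f f') _)
    rw [← hwk]
    exact Submodule.subset_span (by simp)
  · rintro ℓ' ⟨hℓ', h1, h2, h3, h4⟩
    obtain ⟨c, hci⟩ := exists_eq_smul_cross hyi h1 h2
    obtain ⟨s, t, hst, hJ⟩ := exists_eq_pencilVec hβ (ℓ' j).rep_nonzero h3
    obtain ⟨s', t', hst', hK⟩ := exists_eq_pencilVec hγ (ℓ' k).rep_nonzero h4
    have hc0 : c ≠ 0 := fun h0 => (ℓ' i).rep_nonzero (by rw [hci, h0, zero_smul])
    have hI : (ℓ' i).rep ᵥ* C i = c • g := by rw [hci, Matrix.smul_vecMul]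
    have hJ : (ℓ' j).rep ᵥ* C j = s • e + t • f := by rw [hJ, pencilVec_vecMul]
    have hK : (ℓ' k).rep ᵥ* C k = s' • e' + t' • f' := by rw [hK, pencilVec_vecMul]
    have hK0 : (ℓ' k).rep ᵥ* C k ≠ 0 := fun h0 =>
      (ℓ' k).rep_nonzero (vecMul_injective (hC k) (by simpa using h0))
    have hlij : LinearIndependent ℂ ![(ℓ' i).rep ᵥ* C i, (ℓ' j).rep ᵥ* C j] := by
      rw [hI, hJ, LinearIndependent.pair_iff]
      intro p q hpq
      obtain ⟨h1, h2, h3, -⟩ := eq_zero_of_det4_ne_zero hdet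
        (a := p * c) (b := q * s) (c := q * t) (d := 0) (by rw [← hpq]; module)
      refine ⟨(mul_eq_zero.1 h1).resolve_right hc0, ?_⟩
      rcases hst with h0 | h0
      · exact (mul_eq_zero.1 h2).resolve_right h0
      · exact (mul_eq_zero.1 h3).resolve_right h0
    -- The plane of view `k` depends on `g` and a plane of the pencil of `e` and `f`, so it passes
    -- through `g ∩ e ∩ f`. This linear equation fixes the ratio of `s'` and `t'`.
    have hF : s' * det4 g e f e' + t' * det4 g e f f' = 0 := by
      have h0 := mem_span_of_mem_lineMultiviewVariety hℓ' hlij k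
      rw [hI, hJ, hK] at h0
      obtain ⟨p, q, hpq⟩ := Submodule.mem_span_pair.1 h0
      calc s' * det4 g e f e' + t' * det4 g e f f'
          = det4 g e f (s' • e' + t' • f') := by
            simp only [det4_eq, Pi.add_apply, Pi.smul_apply, smul_eq_mul]
            ring
        _ = 0 := by
            rw [← hpq]
            simp only [det4_eq, Pi.add_apply, Pi.smul_apply, smul_eq_mul]
            ring
    have hKw : (ℓ' k).rep ᵥ* C k = (-t' / det4 g e f e') • w := by
      rw [hK, hwdef, joinPlane, smul_sub, smul_smul, smul_smul, sub_eq_add_neg, ← neg_smul]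
      congr 2 <;> field_simp
      linear_combination hF
    refine eq_of_cameraMaps hC hab hc hmaps hℓ' (i := i) (j := k) ?_ ?_ ?_
    · refine linearIndependent_pair_of_dotProduct (c := centerVec (C i)) ?_
        (vecMul_dotProduct_centerVec _ _) ?_
      · rw [hI]
        exact smul_ne_zero hc0 hg0
      · rw [hKw] at hK0 ⊢
        rw [smul_dotProduct]
        exact smul_ne_zero (left_ne_zero_of_smul hK0) hw
    · rw [hI]
      exact Submodule.smul_mem _ _ (Submodule.subset_span (by simp))
    · rw [hKw]
      exact Submodule.smul_mem _ _ (Submodule.subset_span (by simp))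

end Sections

/-! ### Transversals of four lines -/

/-- The coefficient of `s ^ 2` in `transversalForm`. -/
noncomputable def transversalCoeff₁ (e f : Fin 4 → Fin 4 → ℂ) : ℂ :=
  det4 (e 0) (f 1) (e 2) (f 2) * det4 (e 0) (e 1) (e 3) (f 3)
    - det4 (e 0) (e 1) (e 2) (f 2) * det4 (e 0) (f 1) (e 3) (f 3)

/-- The coefficient of `s * t` in `transversalForm`. -/
noncomputable def transversalCoeff₂ (e f : Fin 4 → Fin 4 → ℂ) : ℂ :=
  det4 (f 0) (f 1) (e 2) (f 2) * det4 (e 0) (e 1) (e 3) (f 3)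
    - det4 (f 0) (e 1) (e 2) (f 2) * det4 (e 0) (f 1) (e 3) (f 3)
    + det4 (e 0) (f 1) (e 2) (f 2) * det4 (f 0) (e 1) (e 3) (f 3)
    - det4 (e 0) (e 1) (e 2) (f 2) * det4 (f 0) (f 1) (e 3) (f 3)

/-- The coefficient of `t ^ 2` in `transversalForm`. -/
noncomputable def transversalCoeff₃ (e f : Fin 4 → Fin 4 → ℂ) : ℂ :=
  det4 (f 0) (f 1) (e 2) (f 2) * det4 (f 0) (e 1) (e 3) (f 3)
    - det4 (f 0) (e 1) (e 2) (f 2) * det4 (f 0) (f 1) (e 3) (f 3)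

/-- The determinant of the bilinear form that expresses that the line in which a plane of the first
pencil and a plane of the second pencil intersect meets the third line. -/
noncomputable def incidenceDet (e f : Fin 4 → Fin 4 → ℂ) : ℂ :=
  det4 (e 0) (e 1) (e 2) (f 2) * det4 (f 0) (f 1) (e 2) (f 2)
    - det4 (e 0) (f 1) (e 2) (f 2) * det4 (f 0) (e 1) (e 2) (f 2)

/-- The plane of the second pencil that intersects the plane `s • e 0 + t • f 0` of the first pencil
in a line that meets the third line. -/
noncomputable def secondPlane (e f : Fin 4 → Fin 4 → ℂ) (s t : ℂ) : Fin 4 → ℂ :=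
  (s * det4 (e 0) (f 1) (e 2) (f 2) + t * det4 (f 0) (f 1) (e 2) (f 2)) • e 1
    + (-(s * det4 (e 0) (e 1) (e 2) (f 2) + t * det4 (f 0) (e 1) (e 2) (f 2))) • f 1

section Transversals

variable {e f : Fin 4 → Fin 4 → ℂ}

theorem det4_first_second (a b : Fin 4 → ℂ) (s t u v : ℂ) :
    det4 (s • e 0 + t • f 0) (u • e 1 + v • f 1) a b =
      (s * det4 (e 0) (e 1) a b + t * det4 (f 0) (e 1) a b) * u
        + (s * det4 (e 0) (f 1) a b + t * det4 (f 0) (f 1) a b) * v := by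
  simp only [det4_eq, Pi.add_apply, Pi.smul_apply, smul_eq_mul]
  ring

theorem det4_secondPlane_third (s t : ℂ) :
    det4 (s • e 0 + t • f 0) (secondPlane e f s t) (e 2) (f 2) = 0 := by
  rw [secondPlane, det4_first_second]
  ring

/-- The two planes meet in a line that meets the first three axes by construction; the zeros of this
binary form single out those that meet the fourth. -/
theorem det4_secondPlane_fourth (s t : ℂ) :
    det4 (s • e 0 + t • f 0) (secondPlane e f s t) (e 3) (f 3) =
      transversalCoeff₁ e f * s ^ 2 + transversalCoeff₂ e f * (s * t)
        + transversalCoeff₃ e f * t ^ 2 := by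
  rw [secondPlane, det4_first_second, transversalCoeff₁, transversalCoeff₂, transversalCoeff₃]
  ring

/-- Up to sign, `incidenceDet` is the determinant of the linear map taking `(s, t)` to this pair of
coefficients. -/
theorem secondPlane_coeff_ne_zero (h : incidenceDet e f ≠ 0) {s t : ℂ} (hst : s ≠ 0 ∨ t ≠ 0) :
    s * det4 (e 0) (f 1) (e 2) (f 2) + t * det4 (f 0) (f 1) (e 2) (f 2) ≠ 0 ∨
      -(s * det4 (e 0) (e 1) (e 2) (f 2) + t * det4 (f 0) (e 1) (e 2) (f 2)) ≠ 0 := by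
  by_contra! h0
  obtain ⟨h1, h2⟩ := h0
  have hs : incidenceDet e f * s = 0 := by
    rw [incidenceDet]
    linear_combination -det4 (f 0) (e 1) (e 2) (f 2) * h1 - det4 (f 0) (f 1) (e 2) (f 2) * h2
  have ht : incidenceDet e f * t = 0 := by
    rw [incidenceDet]
    linear_combination det4 (e 0) (e 1) (e 2) (f 2) * h1 + det4 (e 0) (f 1) (e 2) (f 2) * h2
  rcases hst with h0 | h0
  · exact h0 ((mul_eq_zero.1 hs).resolve_left h)
  · exact h0 ((mul_eq_zero.1 ht).resolve_left h)

/-- Pencils with skew axes have no plane in common. -/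
theorem linearIndependent_first_second (h : det4 (e 0) (f 0) (e 1) (f 1) ≠ 0) {s t u v : ℂ}
    (hst : s ≠ 0 ∨ t ≠ 0) (huv : u ≠ 0 ∨ v ≠ 0) :
    LinearIndependent ℂ ![s • e 0 + t • f 0, u • e 1 + v • f 1] := by
  rw [LinearIndependent.pair_iff]
  intro p q hpq
  obtain ⟨h1, h2, h3, h4⟩ := eq_zero_of_det4_ne_zero h (a := p * s) (b := p * t) (c := q * u)
    (d := q * v) (by rw [← hpq]; module)
  constructor
  · rcases hst with h0 | h0
    · exact (mul_eq_zero.1 h1).resolve_right h0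
    · exact (mul_eq_zero.1 h2).resolve_right h0
  · rcases huv with h0 | h0
    · exact (mul_eq_zero.1 h3).resolve_right h0
    · exact (mul_eq_zero.1 h4).resolve_right h0

theorem exists_smul_secondPlane (h : incidenceDet e f ≠ 0) {s t u v : ℂ} (hst : s ≠ 0 ∨ t ≠ 0)
    (h0 : det4 (s • e 0 + t • f 0) (u • e 1 + v • f 1) (e 2) (f 2) = 0) :
    ∃ κ : ℂ, u • e 1 + v • f 1 = κ • secondPlane e f s t := by
  have hne := secondPlane_coeff_ne_zero h hst
  rw [det4_first_second] at h0
  rw [secondPlane]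
  set A := s * det4 (e 0) (f 1) (e 2) (f 2) + t * det4 (f 0) (f 1) (e 2) (f 2)
  set B := s * det4 (e 0) (e 1) (e 2) (f 2) + t * det4 (f 0) (e 1) (e 2) (f 2)
  rcases hne with hA | hB
  · refine ⟨u / A, ?_⟩
    rw [smul_add, smul_smul, smul_smul]
    congr 2 <;> field_simp
    linear_combination h0
  · have hB : B ≠ 0 := neg_ne_zero.1 hB
    refine ⟨-v / B, ?_⟩
    rw [smul_add, smul_smul, smul_smul]
    congr 2 <;> field_simp
    linear_combination h0

end Transversals

/-- Four pencils of planes, with bases `e x`, `f x`, are general with respect to the points `c n`: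
the axes of the pencils have two transversals, which contain none of the points. -/
structure PencilsGeneral {ι : Type} (c : ι → Fin 4 → ℂ) (e f : Fin 4 → Fin 4 → ℂ) : Prop where
  skew : det4 (e 0) (f 0) (e 1) (f 1) ≠ 0
  incidenceDet_ne : incidenceDet e f ≠ 0
  -- No transversal lies in the plane `e 0`, so each root can be normalised to `t = 1`.
  coeff_ne : transversalCoeff₁ e f ≠ 0
  discrim_ne : discrim (transversalCoeff₁ e f) (transversalCoeff₂ e f) (transversalCoeff₃ e f) ≠ 0
  -- The three axes depend on `n`: a center on one of the axes makes the corresponding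
  -- `planeThrough` zero, so that axis cannot be used.
  point : ∀ n, ∃ (x : Fin 3 → Fin 4) (v : Fin 4 → ℂ),
    det4 (planeThrough (e (x 0)) (f (x 0)) (c n)) (planeThrough (e (x 1)) (f (x 1)) (c n))
      (planeThrough (e (x 2)) (f (x 2)) (c n)) v ≠ 0

section FourLines

variable {m : ℕ} {C : Fin m → Matrix (Fin 3) (Fin 4) ℂ} {i : Fin 4 → Fin m} {α : Fin 4 → Fin 3 → ℂ}

/-- Necessity: the line in which the planes of views `i 0` and `i 1` meet must also meet the other
two axes. The third axis determines the second plane from the first, and the fourth gives the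
quadratic equation. -/
theorem exists_planes_of_mem (hα : ∀ x, α x 0 ≠ 0)
    (h : PencilsGeneral (fun n => centerVec (C n)) (fun x => backPencil₁ (C (i x)) (α x))
      fun x => backPencil₂ (C (i x)) (α x)) {ℓ : Fin m → PTwo} (hℓ : ℓ ∈ lineMultiviewVariety C)
    (hαℓ : ∀ x, α x ⬝ᵥ (ℓ (i x)).rep = 0) :
    LinearIndependent ℂ ![(ℓ (i 0)).rep ᵥ* C (i 0), (ℓ (i 1)).rep ᵥ* C (i 1)] ∧
      ∃ s t : ℂ, (s ≠ 0 ∨ t ≠ 0) ∧ (ℓ (i 0)).rep = pencilVec (α 0) s t ∧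
        (∃ κ : ℂ, (ℓ (i 1)).rep ᵥ* C (i 1) =
          κ • secondPlane (fun x => backPencil₁ (C (i x)) (α x))
            (fun x => backPencil₂ (C (i x)) (α x)) s t) ∧
        transversalCoeff₁ (fun x => backPencil₁ (C (i x)) (α x))
            (fun x => backPencil₂ (C (i x)) (α x)) * s ^ 2
          + transversalCoeff₂ (fun x => backPencil₁ (C (i x)) (α x))
            (fun x => backPencil₂ (C (i x)) (α x)) * (s * t)
          + transversalCoeff₃ (fun x => backPencil₁ (C (i x)) (α x))
            (fun x => backPencil₂ (C (i x)) (α x)) * t ^ 2 = 0 := by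
  set e : Fin 4 → Fin 4 → ℂ := fun x => backPencil₁ (C (i x)) (α x) with he
  set f : Fin 4 → Fin 4 → ℂ := fun x => backPencil₂ (C (i x)) (α x) with hf
  choose p q hpq hrep using fun x => exists_eq_pencilVec (hα x) (ℓ (i x)).rep_nonzero (hαℓ x)
  have hback (x : Fin 4) : (ℓ (i x)).rep ᵥ* C (i x) = p x • e x + q x • f x := by
    rw [hrep]
    exact pencilVec_vecMul _ _ _ _
  have hij : LinearIndependent ℂ ![(ℓ (i 0)).rep ᵥ* C (i 0), (ℓ (i 1)).rep ᵥ* C (i 1)] := by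
    rw [hback, hback]
    exact linearIndependent_first_second h.skew (hpq 0) (hpq 1)
  have hdet (x : Fin 4) : det4 (p 0 • e 0 + q 0 • f 0) (p 1 • e 1 + q 1 • f 1) (e x) (f x) = 0 := by
    have := mem_span_of_mem_lineMultiviewVariety hℓ hij (i x)
    rw [hback 0, hback 1, hback x] at this
    exact det4_eq_zero_of_smul_add_smul_mem_span (hpq x) this
  obtain ⟨κ, hκ⟩ := exists_smul_secondPlane h.incidenceDet_ne (hpq 0) (hdet 2)
  refine ⟨hij, p 0, q 0, hpq 0, hrep 0, ⟨κ, (hback 1).trans hκ⟩, ?_⟩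
  have hκ0 : κ ≠ 0 := by
    rintro rfl
    rw [zero_smul, ← hback] at hκ
    exact hij.ne_zero 1 hκ
  have h3 := hdet 3
  rw [hκ] at h3
  have h3' : κ * det4 (p 0 • e 0 + q 0 • f 0) (secondPlane e f (p 0) (q 0)) (e 3) (f 3) = 0 := by
    rw [← h3]
    simp only [det4_eq, Pi.smul_apply, smul_eq_mul]
    ring
  rw [← det4_secondPlane_fourth]
  exact (mul_eq_zero.1 h3').resolve_left hκ0

/-- Sufficiency: a root yields two planes whose intersection meets all four axes, and the first
plane determines the second and hence the line. -/
theorem exists_unique_of_root (hC : ∀ n, centerVec (C n) ≠ 0) (hα : ∀ x, α x 0 ≠ 0)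
    (h : PencilsGeneral (fun n => centerVec (C n)) (fun x => backPencil₁ (C (i x)) (α x))
      fun x => backPencil₂ (C (i x)) (α x)) {s : ℂ}
    (hs : transversalCoeff₁ (fun x => backPencil₁ (C (i x)) (α x))
        (fun x => backPencil₂ (C (i x)) (α x)) * (s * s)
      + transversalCoeff₂ (fun x => backPencil₁ (C (i x)) (α x))
        (fun x => backPencil₂ (C (i x)) (α x)) * s
      + transversalCoeff₃ (fun x => backPencil₁ (C (i x)) (α x))
        (fun x => backPencil₂ (C (i x)) (α x)) = 0) :
    ∃ ℓ ∈ lineMultiviewVariety C, (∀ x, α x ⬝ᵥ (ℓ (i x)).rep = 0) ∧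
      (∃ c : ℂ, (ℓ (i 0)).rep = c • pencilVec (α 0) s 1) ∧
      ∀ ℓ' ∈ lineMultiviewVariety C, (∀ x, α x ⬝ᵥ (ℓ' (i x)).rep = 0) →
        (∃ t : ℂ, (ℓ' (i 0)).rep = pencilVec (α 0) (t * s) t) → ℓ' = ℓ := by
  have hst : s ≠ 0 ∨ (1 : ℂ) ≠ 0 := Or.inr one_ne_zero
  set e : Fin 4 → Fin 4 → ℂ := fun x => backPencil₁ (C (i x)) (α x) with he
  set f : Fin 4 → Fin 4 → ℂ := fun x => backPencil₂ (C (i x)) (α x) with hf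
  have hvec (x : Fin 4) (p q : ℂ) : pencilVec (α x) p q ᵥ* C (i x) = p • e x + q • f x :=
    pencilVec_vecMul _ _ _ _
  have huv := secondPlane_coeff_ne_zero h.incidenceDet_ne hst
  have hab : LinearIndependent ℂ ![s • e 0 + (1 : ℂ) • f 0, secondPlane e f s 1] :=
    linearIndependent_first_second h.skew hst huv
  have hplane : ∀ x : Fin 4, ∃ p q : ℂ, (p ≠ 0 ∨ q ≠ 0) ∧ p • e x + q • f x ∈
      Submodule.span ℂ {s • e 0 + (1 : ℂ) • f 0, secondPlane e f s 1} := by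
    have h2 := exists_mem_span_of_det4_eq_zero hab (det4_secondPlane_third s 1)
    have h3 := exists_mem_span_of_det4_eq_zero hab (e := e 3) (f := f 3) (by
      rw [det4_secondPlane_fourth, ← hs]
      ring)
    intro x
    fin_cases x
    · exact ⟨s, 1, hst, Submodule.subset_span (by simp)⟩
    · exact ⟨_, _, huv, Submodule.subset_span (by simp [secondPlane])⟩
    · exact h2
    · exact h3
  choose p q hpq hmem using hplane
  -- Through a center on this line, the planes joining it to three of the axes would all contain the
  -- line and so be dependent, against `h.point`.
  have hc (n : Fin m) : centerVec (C n) ∉ lineOf (s • e 0 + (1 : ℂ) • f 0) (secondPlane e f s 1) := by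
    obtain ⟨x, v, hx⟩ := h.point n
    exact notMem_lineOf (e := fun y => e (x y)) (f := fun y => f (x y)) (s := fun y => p (x y))
      (t := fun y => q (x y)) (fun y => hpq _) (fun y => hmem _) hx
  obtain ⟨ℓ, hℓ, hmaps⟩ := exists_forall_cameraMaps hC hab hc
  refine ⟨ℓ, hℓ, fun x => ?_, ?_, ?_⟩
  · exact (hmaps (i x)).dotProduct_rep hab (pencilVec_ne_zero (hα x) (hpq x))
      (by rw [hvec]; exact hmem x) (dotProduct_pencilVec _ _ _)
  · refine (hmaps (i 0)).exists_rep_eq_smul (finrank_lineOf hab) (pencilVec_ne_zero (hα 0) hst)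
      fun v hv => dotProduct_eq_zero_of_mem_span_pair ?_ hv
    rw [hvec]
    exact Submodule.subset_span (by simp)
  · rintro ℓ' hℓ' hα' ⟨t, ht⟩
    obtain ⟨hij, p', q', -, hrep, ⟨κ, hκ⟩, -⟩ := exists_planes_of_mem hα h hℓ' hα'
    have hp : p' = t * s ∧ q' = t := pencilVec_injective (hα 0) (hrep.symm.trans ht)
    refine eq_of_cameraMaps hC hab hc hmaps hℓ' hij ?_ ?_
    · have : (ℓ' (i 0)).rep ᵥ* C (i 0) = t • (s • e 0 + (1 : ℂ) • f 0) := by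
        rw [ht, hvec]
        module
      rw [this]
      exact Submodule.smul_mem _ _ (Submodule.subset_span (by simp))
    · have : secondPlane e f (t * s) t = t • secondPlane e f s 1 := by
        rw [secondPlane, secondPlane]
        module
      rw [hκ, hp.1, hp.2, this]
      exact Submodule.smul_mem _ _ (Submodule.smul_mem _ _ (Submodule.subset_span (by simp)))

theorem encard_eq_two_of_four_lines (hC : ∀ n, centerVec (C n) ≠ 0) (hα : ∀ x, α x 0 ≠ 0)
    (h : PencilsGeneral (fun n => centerVec (C n)) (fun x => backPencil₁ (C (i x)) (α x))
      fun x => backPencil₂ (C (i x)) (α x)) :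
    (lineMultiviewVariety C ∩ {ℓ | ∀ x, α x ⬝ᵥ (ℓ (i x)).rep = 0}).encard = 2 := by
  have hroot (s : ℂ) := exists_unique_of_root (s := s) hC hα h
  have hmem (ℓ : Fin m → PTwo) := exists_planes_of_mem (ℓ := ℓ) hα h
  obtain ⟨-, -, hA, hdisc, -⟩ := h
  set A := transversalCoeff₁ (fun x => backPencil₁ (C (i x)) (α x))
    fun x => backPencil₂ (C (i x)) (α x)
  set B := transversalCoeff₂ (fun x => backPencil₁ (C (i x)) (α x))
    fun x => backPencil₂ (C (i x)) (α x)
  set D := transversalCoeff₃ (fun x => backPencil₁ (C (i x)) (α x))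
    fun x => backPencil₂ (C (i x)) (α x)
  obtain ⟨δ, hδ⟩ := IsAlgClosed.exists_eq_mul_self (discrim A B D)
  have hδ0 : δ ≠ 0 := by
    rintro rfl
    exact hdisc (by rw [hδ, mul_zero])
  have hiff := quadratic_eq_zero_iff hA hδ
  have hne : (-B + δ) / (2 * A) ≠ (-B - δ) / (2 * A) := by
    intro h0
    field_simp at h0
    exact hδ0 (by linear_combination h0 / 2)
  obtain ⟨ℓ₁, hℓ₁, hα₁, ⟨c₁, hc₁⟩, huniq₁⟩ := hroot _ ((hiff _).2 (.inl rfl))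
  obtain ⟨ℓ₂, hℓ₂, hα₂, ⟨c₂, hc₂⟩, huniq₂⟩ := hroot _ ((hiff _).2 (.inr rfl))
  -- Distinct roots give distinct planes of the first pencil, so the points already differ in view
  -- `i 0`.
  have hℓ : ℓ₁ ≠ ℓ₂ := by
    rintro rfl
    have hcc : pencilVec (α 0) (c₁ * ((-B + δ) / (2 * A))) c₁ =
        pencilVec (α 0) (c₂ * ((-B - δ) / (2 * A))) c₂ := by
      rw [← mul_one c₁, ← mul_one c₂, mul_assoc, mul_assoc, one_mul, one_mul, ← smul_pencilVec,
        ← smul_pencilVec, ← hc₁, ← hc₂]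
    obtain ⟨h1, h2⟩ := pencilVec_injective (hα 0) hcc
    have hc0 : c₁ ≠ 0 := fun h0 => (ℓ₁ (i 0)).rep_nonzero (by rw [hc₁, h0, zero_smul])
    rw [← h2] at h1
    exact hne (mul_left_cancel₀ hc0 h1)
  rw [← Set.encard_pair hℓ]
  congr 1
  ext ℓ'
  constructor
  · rintro ⟨hℓ', hα'⟩
    obtain ⟨-, s, t, hst, hrep, -, hQ⟩ := hmem ℓ' hℓ' hα'
    have ht : t ≠ 0 := by
      rintro rfl
      have hs : s ≠ 0 := by simpa using hst
      exact mul_ne_zero hA (pow_ne_zero 2 hs) (by simpa using hQ)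
    have hs : t * (s / t) = s := by field_simp
    have hQ' : A * (s / t * (s / t)) + B * (s / t) + D = 0 := by
      field_simp
      linear_combination hQ
    rcases (hiff _).1 hQ' with h0 | h0
    · exact .inl (huniq₁ ℓ' hℓ' hα' ⟨t, by rw [← h0, hs, hrep]⟩)
    · exact .inr (huniq₂ ℓ' hℓ' hα' ⟨t, by rw [← h0, hs, hrep]⟩)
  · rintro (rfl | rfl)
    · exact ⟨hℓ₁, hα₁⟩
    · exact ⟨hℓ₂, hα₂⟩

end FourLines

/-! ### Constructions depending polynomially on the data -/

/-- A vector of polynomial functions. -/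
def IsPolyVec {σ : Type} {n : ℕ} (v : (σ → ℂ) → Fin n → ℂ) : Prop := ∀ k, IsPolyFun fun A => v A k

namespace IsPolyVec

variable {σ : Type} {n : ℕ}

theorem const (v : Fin n → ℂ) : IsPolyVec fun _ : σ → ℂ => v := fun _ => .const _

theorem sub {u v : (σ → ℂ) → Fin n → ℂ} (hu : IsPolyVec u) (hv : IsPolyVec v) :
    IsPolyVec fun A => u A - v A := fun k => (hu k).sub (hv k)

theorem smul {f : (σ → ℂ) → ℂ} {v : (σ → ℂ) → Fin n → ℂ} (hf : IsPolyFun f) (hv : IsPolyVec v) :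
    IsPolyVec fun A => f A • v A := fun k => hf.mul (hv k)

theorem dotProduct {u v : (σ → ℂ) → Fin n → ℂ} (hu : IsPolyVec u) (hv : IsPolyVec v) :
    IsPolyFun fun A => u A ⬝ᵥ v A := IsPolyFun.dotProduct hu hv

theorem det4 {u v w x : (σ → ℂ) → Fin 4 → ℂ} (hu : IsPolyVec u) (hv : IsPolyVec v)
    (hw : IsPolyVec w) (hx : IsPolyVec x) : IsPolyFun fun A => det4 (u A) (v A) (w A) (x A) := by
  refine IsPolyFun.det fun r k => ?_
  fin_cases r
  exacts [hu k, hv k, hw k, hx k]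

theorem cross {u v : (σ → ℂ) → Fin 3 → ℂ} (hu : IsPolyVec u) (hv : IsPolyVec v) :
    IsPolyVec fun A => crossProduct (u A) (v A) := by
  intro k
  simp only [cross_apply]
  fin_cases k
  · exact ((hu 1).mul (hv 2)).sub ((hu 2).mul (hv 1))
  · exact ((hu 2).mul (hv 0)).sub ((hu 0).mul (hv 2))
  · exact ((hu 0).mul (hv 1)).sub ((hu 1).mul (hv 0))

theorem vecMul {v : (σ → ℂ) → Fin 3 → ℂ} {M : (σ → ℂ) → Matrix (Fin 3) (Fin 4) ℂ}
    (hv : IsPolyVec v) (hM : ∀ r, IsPolyVec fun A => M A r) : IsPolyVec fun A => v A ᵥ* M A :=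
  fun k => IsPolyFun.dotProduct hv fun r => hM r k

theorem backPencil₁ {v : (σ → ℂ) → Fin 3 → ℂ} {M : (σ → ℂ) → Matrix (Fin 3) (Fin 4) ℂ}
    (hM : ∀ r, IsPolyVec fun A => M A r) (hv : IsPolyVec v) :
    IsPolyVec fun A => backPencil₁ (M A) (v A) := by
  refine vecMul (fun k => ?_) hM
  fin_cases k
  · simpa [pencilBasis₁] using (IsPolyFun.const 0).sub (hv 1)
  · exact hv 0
  · exact .const 0

theorem backPencil₂ {v : (σ → ℂ) → Fin 3 → ℂ} {M : (σ → ℂ) → Matrix (Fin 3) (Fin 4) ℂ}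
    (hM : ∀ r, IsPolyVec fun A => M A r) (hv : IsPolyVec v) :
    IsPolyVec fun A => backPencil₂ (M A) (v A) := by
  refine vecMul (fun k => ?_) hM
  fin_cases k
  · simpa [pencilBasis₂] using (IsPolyFun.const 0).sub (hv 2)
  · exact .const 0
  · exact hv 0

theorem centerVec {M : (σ → ℂ) → Matrix (Fin 3) (Fin 4) ℂ} (hM : ∀ r, IsPolyVec fun A => M A r) :
    IsPolyVec fun A => centerVec (M A) := fun _ => det4 (hM 0) (hM 1) (hM 2) (const _)

theorem planeThrough {e f c : (σ → ℂ) → Fin 4 → ℂ} (he : IsPolyVec e) (hf : IsPolyVec f)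
    (hc : IsPolyVec c) : IsPolyVec fun A => planeThrough (e A) (f A) (c A) :=
  (smul (hf.dotProduct hc) he).sub (smul (he.dotProduct hc) hf)

theorem joinPlane {g e' f' e f : (σ → ℂ) → Fin 4 → ℂ} (hg : IsPolyVec g) (he' : IsPolyVec e')
    (hf' : IsPolyVec f') (he : IsPolyVec e) (hf : IsPolyVec f) :
    IsPolyVec fun A => joinPlane (g A) (e' A) (f' A) (e A) (f A) :=
  (smul (det4 hg he' hf' hf) he).sub (smul (det4 hg he' hf' he) hf)

theorem incidenceDet {e f : (σ → ℂ) → Fin 4 → Fin 4 → ℂ} (he : ∀ x, IsPolyVec fun A => e A x)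
    (hf : ∀ x, IsPolyVec fun A => f A x) : IsPolyFun fun A => incidenceDet (e A) (f A) :=
  ((det4 (he 0) (he 1) (he 2) (hf 2)).mul (det4 (hf 0) (hf 1) (he 2) (hf 2))).sub
    ((det4 (he 0) (hf 1) (he 2) (hf 2)).mul (det4 (hf 0) (he 1) (he 2) (hf 2)))

theorem transversalCoeff₁ {e f : (σ → ℂ) → Fin 4 → Fin 4 → ℂ} (he : ∀ x, IsPolyVec fun A => e A x)
    (hf : ∀ x, IsPolyVec fun A => f A x) : IsPolyFun fun A => transversalCoeff₁ (e A) (f A) :=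
  ((det4 (he 0) (hf 1) (he 2) (hf 2)).mul (det4 (he 0) (he 1) (he 3) (hf 3))).sub
    ((det4 (he 0) (he 1) (he 2) (hf 2)).mul (det4 (he 0) (hf 1) (he 3) (hf 3)))

theorem transversalCoeff₂ {e f : (σ → ℂ) → Fin 4 → Fin 4 → ℂ} (he : ∀ x, IsPolyVec fun A => e A x)
    (hf : ∀ x, IsPolyVec fun A => f A x) : IsPolyFun fun A => transversalCoeff₂ (e A) (f A) :=
  ((((det4 (hf 0) (hf 1) (he 2) (hf 2)).mul (det4 (he 0) (he 1) (he 3) (hf 3))).sub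
    ((det4 (hf 0) (he 1) (he 2) (hf 2)).mul (det4 (he 0) (hf 1) (he 3) (hf 3)))).add
    ((det4 (he 0) (hf 1) (he 2) (hf 2)).mul (det4 (hf 0) (he 1) (he 3) (hf 3)))).sub
    ((det4 (he 0) (he 1) (he 2) (hf 2)).mul (det4 (hf 0) (hf 1) (he 3) (hf 3)))

theorem transversalCoeff₃ {e f : (σ → ℂ) → Fin 4 → Fin 4 → ℂ} (he : ∀ x, IsPolyVec fun A => e A x)
    (hf : ∀ x, IsPolyVec fun A => f A x) : IsPolyFun fun A => transversalCoeff₃ (e A) (f A) :=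
  ((det4 (hf 0) (hf 1) (he 2) (hf 2)).mul (det4 (hf 0) (he 1) (he 3) (hf 3))).sub
    ((det4 (hf 0) (he 1) (he 2) (hf 2)).mul (det4 (hf 0) (hf 1) (he 3) (hf 3)))

theorem cameraTuple {m : ℕ} (n : Fin m) (r : Fin 3) :
    IsPolyVec fun A : Fin m × Fin 3 × Fin 4 → ℂ => cameraTuple A n r := fun k => .coord (n, r, k)

end IsPolyVec

/-! ### General cameras -/

section Cameras

variable {m : ℕ}

theorem generic_centerVec_ne_zero :
    HoldsGenerically fun A : Fin m × Fin 3 × Fin 4 → ℂ => ∀ n, centerVec (cameraTuple A n) ≠ 0 := by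
  refine .all fun n => ?_
  have := (IsPolyVec.centerVec (IsPolyVec.cameraTuple n) 3).holdsGenerically
    ⟨fun v => !![1, 0, 0, 0; 0, 1, 0, 0; 0, 0, 1, 0] v.2.1 v.2.2, by
      simp [centerVec, cameraTuple, det4_eq]⟩
  exact this.mono fun A hA h0 => hA (congrFun h0 3)

theorem generic_center_ne :
    HoldsGenerically fun A : Fin m × Fin 3 × Fin 4 → ℂ =>
      ∀ i j, i ≠ j → cameraCenter (cameraTuple A i) ≠ cameraCenter (cameraTuple A j) := by
  refine .all fun i => .all fun j => .imp fun hij => ?_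
  have := ((IsPolyVec.cameraTuple j 0).dotProduct
    (IsPolyVec.centerVec (IsPolyVec.cameraTuple i))).holdsGenerically
    ⟨fun v => if v.1 = i then !![1, 0, 0, 0; 0, 1, 0, 0; 0, 0, 1, 0] v.2.1 v.2.2
      else !![0, 0, 0, 1; 0, 0, 0, 0; 0, 0, 0, 0] v.2.1 v.2.2, by
      simp [dotProduct_centerVec, cameraTuple, det4_eq, hij.symm]⟩
  refine this.mono fun A hA h0 => hA ?_
  have hmem : centerVec (cameraTuple A i) ∈ cameraCenter (cameraTuple A i) := mulVec_centerVec _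
  rw [h0] at hmem
  exact congrFun hmem 0

theorem generic_noFourCollinear :
    HoldsGenerically fun A : Fin m × Fin 3 × Fin 4 → ℂ => NoFourCollinear (cameraTuple A) := by
  refine .all fun i => .all fun j => .all fun k => .all fun l => .imp fun hnd => ?_
  simp only [List.nodup_cons, List.mem_cons, not_or] at hnd
  obtain ⟨⟨hij, hik, -⟩, ⟨hjk, -⟩, -⟩ := hnd
  have hp (n : Fin m) := IsPolyVec.centerVec (IsPolyVec.cameraTuple n)
  have := (IsPolyVec.det4 (hp i) (hp j) (hp k) (.const (Pi.single 0 1))).holdsGenerically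
    -- The kernels of these coordinate projections are, up to sign, spanned by three unit vectors,
    -- which `Pi.single 0 1` completes to a basis.
    ⟨fun v => if v.1 = i then !![1, 0, 0, 0; 0, 1, 0, 0; 0, 0, 1, 0] v.2.1 v.2.2
      else if v.1 = j then !![1, 0, 0, 0; 0, 1, 0, 0; 0, 0, 0, 1] v.2.1 v.2.2
      else !![1, 0, 0, 0; 0, 0, 1, 0; 0, 0, 0, 1] v.2.1 v.2.2, by
      simp [centerVec, cameraTuple, det4_eq, Ne.symm hij, Ne.symm hik, Ne.symm hjk]⟩
  refine this.mono fun A hA => ?_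
  have hli := (det4_ne_zero_iff.1 hA).comp (Fin.castSucc : Fin 3 → Fin 4)
    (Fin.castSucc_injective _)
  have hle : Submodule.span ℂ (Set.range (![centerVec (cameraTuple A i),
      centerVec (cameraTuple A j), centerVec (cameraTuple A k), Pi.single 0 1] ∘ Fin.castSucc)) ≤
      cameraCenter (cameraTuple A i) ⊔ cameraCenter (cameraTuple A j) ⊔
        cameraCenter (cameraTuple A k) ⊔ cameraCenter (cameraTuple A l) := by
    have hmem (n : Fin m) : centerVec (cameraTuple A n) ∈ cameraCenter (cameraTuple A n) :=
      mulVec_centerVec _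
    rw [Submodule.span_le]
    rintro _ ⟨x, rfl⟩
    fin_cases x
    · exact Submodule.mem_sup_left (Submodule.mem_sup_left (Submodule.mem_sup_left (hmem i)))
    · exact Submodule.mem_sup_left (Submodule.mem_sup_left (Submodule.mem_sup_right (hmem j)))
    · exact Submodule.mem_sup_left (Submodule.mem_sup_right (hmem k))
  have := Submodule.finrank_mono hle
  rw [finrank_span_eq_card hli, Fintype.card_fin] at this
  exact this

end Cameras

/-! ### General cameras together with general forms -/

theorem centerVec_standard :
    centerVec !![1, 0, 0, 0; 0, 1, 0, 0; 0, 0, 1, 0] = ![0, 0, 0, 1] := by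
  funext k
  fin_cases k <;> simp [centerVec, det4_eq]

section CamerasAndForms

variable {m : ℕ} {S : Type}

/-- The cameras among the data of cameras and linear forms. -/
def camerasOf (A : (Fin m × Fin 3 × Fin 4) ⊕ (S × Fin 3) → ℂ) :
    Fin m → Matrix (Fin 3) (Fin 4) ℂ := cameraTuple fun v => A (.inl v)

/-- The linear forms among the data of cameras and linear forms. -/
def formsOf (A : (Fin m × Fin 3 × Fin 4) ⊕ (S × Fin 3) → ℂ) (s : S) : Fin 3 → ℂ :=
  fun k => A (.inr (s, k))

theorem isPolyVec_camerasOf (n : Fin m) (r : Fin 3) :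
    IsPolyVec fun A : (Fin m × Fin 3 × Fin 4) ⊕ (S × Fin 3) → ℂ => camerasOf A n r :=
  fun k => .coord (Sum.inl (n, r, k))

theorem isPolyVec_formsOf (s : S) :
    IsPolyVec fun A : (Fin m × Fin 3 × Fin 4) ⊕ (S × Fin 3) → ℂ => formsOf A s :=
  fun k => .coord (Sum.inr (s, k))

theorem exists_camerasOf_formsOf (C : Fin m → Matrix (Fin 3) (Fin 4) ℂ) (a : S → Fin 3 → ℂ) :
    ∃ A : (Fin m × Fin 3 × Fin 4) ⊕ (S × Fin 3) → ℂ, camerasOf A = C ∧ formsOf A = a :=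
  ⟨Sum.elim (fun v => C v.1 v.2.1 v.2.2) fun v => a v.1 v.2, rfl, rfl⟩

theorem generic_centerVec_camerasOf_ne_zero :
    HoldsGenerically fun A : (Fin m × Fin 3 × Fin 4) ⊕ (S × Fin 3) → ℂ =>
      ∀ n, centerVec (camerasOf A n) ≠ 0 :=
  generic_centerVec_ne_zero.sumInl

theorem generic_form_ne_zero (s : S) :
    HoldsGenerically fun A : (Fin m × Fin 3 × Fin 4) ⊕ (S × Fin 3) → ℂ => formsOf A s 0 ≠ 0 := by
  refine (isPolyVec_formsOf s 0).holdsGenerically ?_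
  obtain ⟨A, -, hA⟩ := exists_camerasOf_formsOf (S := S) (0 : Fin m → _) fun _ => ![1, 0, 0]
  exact ⟨A, by simp [hA]⟩

-- The plane of view `i` contains its own center but in general no other. The witness camera `i` has
-- rank 1, which is harmless: only one nonzero value of the polynomial is needed.
open Classical in
theorem generic_cross_dotProduct {n i : Fin m} (hn : n ≠ i) {s s' : S} (hs : s ≠ s') :
    HoldsGenerically fun A : (Fin m × Fin 3 × Fin 4) ⊕ (S × Fin 3) → ℂ =>
      (crossProduct (formsOf A s) (formsOf A s') ᵥ* camerasOf A i) ⬝ᵥ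
        centerVec (camerasOf A n) ≠ 0 := by
  refine ((((isPolyVec_formsOf s).cross (isPolyVec_formsOf s')).vecMul
    (isPolyVec_camerasOf i)).dotProduct (.centerVec (isPolyVec_camerasOf n))).holdsGenerically ?_
  obtain ⟨A, hC, ha⟩ := exists_camerasOf_formsOf (S := S)
    (fun x => if x = i then !![0, 0, 0, 0; 0, 0, 0, 0; 0, 0, 0, 1]
      else !![1, 0, 0, 0; 0, 1, 0, 0; 0, 0, 1, 0])
    fun x => if x = s then ![1, 0, 0] else ![0, 1, 0]
  exact ⟨A, by simp [hC, ha, hn, hs.symm, centerVec_standard, cross_apply]⟩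

open Classical in
theorem generic_det4_cross {i j k : Fin m} (hij : i ≠ j) (hik : i ≠ k) (hjk : j ≠ k)
    {s s' u v : S} (hs : s ≠ s') (hu : u ≠ s') (hv : v ≠ s') :
    HoldsGenerically fun A : (Fin m × Fin 3 × Fin 4) ⊕ (S × Fin 3) → ℂ =>
      det4 (crossProduct (formsOf A s) (formsOf A s') ᵥ* camerasOf A i)
        (backPencil₁ (camerasOf A j) (formsOf A u)) (backPencil₂ (camerasOf A j) (formsOf A u))
        (backPencil₁ (camerasOf A k) (formsOf A v)) ≠ 0 := by
  refine (IsPolyVec.det4 (((isPolyVec_formsOf s).cross (isPolyVec_formsOf s')).vecMul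
    (isPolyVec_camerasOf i)) (.backPencil₁ (isPolyVec_camerasOf j) (isPolyVec_formsOf u))
    (.backPencil₂ (isPolyVec_camerasOf j) (isPolyVec_formsOf u))
    (.backPencil₁ (isPolyVec_camerasOf k) (isPolyVec_formsOf v))).holdsGenerically ?_
  -- The form `![1, 0, 0]` has pencil basis rows 1 and 2 of its camera, and the cross product
  -- selects row 2. The four planes become the coordinate planes.
  obtain ⟨A, hC, ha⟩ := exists_camerasOf_formsOf (S := S)
    (fun x => if x = i then !![0, 0, 0, 0; 0, 0, 0, 0; 1, 0, 0, 0]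
      else if x = j then !![0, 0, 0, 0; 0, 1, 0, 0; 0, 0, 1, 0]
      else !![0, 0, 0, 0; 0, 0, 0, 1; 0, 0, 0, 0])
    fun x => if x = s' then ![0, 1, 0] else ![1, 0, 0]
  exact ⟨A, by simp [hC, ha, hij.symm, hik.symm, hjk.symm, hs, hu, hv, det4_eq, cross_apply,
    backPencil₁, backPencil₂, pencilBasis₁, pencilBasis₂]⟩

open Classical in
theorem generic_joinPlane {i j k : Fin m} (hij : i ≠ j) (hik : i ≠ k) (hjk : j ≠ k)
    {s s' u v : S} (hs : s ≠ s') (hu : u ≠ s') (hv : v ≠ s') :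
    HoldsGenerically fun A : (Fin m × Fin 3 × Fin 4) ⊕ (S × Fin 3) → ℂ =>
      joinPlane (crossProduct (formsOf A s) (formsOf A s') ᵥ* camerasOf A i)
        (backPencil₁ (camerasOf A j) (formsOf A u)) (backPencil₂ (camerasOf A j) (formsOf A u))
        (backPencil₁ (camerasOf A k) (formsOf A v)) (backPencil₂ (camerasOf A k) (formsOf A v)) ⬝ᵥ
        centerVec (camerasOf A i) ≠ 0 := by
  refine ((IsPolyVec.joinPlane (((isPolyVec_formsOf s).cross (isPolyVec_formsOf s')).vecMul
    (isPolyVec_camerasOf i)) (.backPencil₁ (isPolyVec_camerasOf j) (isPolyVec_formsOf u))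
    (.backPencil₂ (isPolyVec_camerasOf j) (isPolyVec_formsOf u))
    (.backPencil₁ (isPolyVec_camerasOf k) (isPolyVec_formsOf v))
    (.backPencil₂ (isPolyVec_camerasOf k) (isPolyVec_formsOf v))).dotProduct
    (.centerVec (isPolyVec_camerasOf i))).holdsGenerically ?_
  -- Here the first pencil vector of view `k` lies in the span of the first three planes, so
  -- `joinPlane` is a multiple of it; it is the last coordinate plane, which misses the center `![0,
  -- 0, 0, 1]`.
  obtain ⟨A, hC, ha⟩ := exists_camerasOf_formsOf (S := S)
    (fun x => if x = i then !![1, 0, 0, 0; 0, 1, 0, 0; 0, 0, 1, 0]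
      else if x = j then !![0, 0, 0, 0; 1, 0, 0, 0; 0, 0, 0, 1]
      else !![0, 0, 0, 0; 0, 0, 0, 1; 0, 1, 0, 0])
    fun x => if x = s' then ![0, 1, 0] else ![1, 0, 0]
  exact ⟨A, by simp [hC, ha, hij.symm, hik.symm, hjk.symm, hs, hu, hv, centerVec_standard,
    det4_eq, cross_apply, joinPlane, backPencil₁, backPencil₂, pencilBasis₁, pencilBasis₂]⟩

theorem generic_planeThrough {n p q r : Fin m} (hp : p ≠ n) (hq : q ≠ n) (hr : r ≠ n) (hpq : q ≠ p)
    (hpr : r ≠ p) (hqr : r ≠ q) (s t u : S) :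
    HoldsGenerically fun A : (Fin m × Fin 3 × Fin 4) ⊕ (S × Fin 3) → ℂ =>
      det4
        (planeThrough (backPencil₁ (camerasOf A p) (formsOf A s))
          (backPencil₂ (camerasOf A p) (formsOf A s)) (centerVec (camerasOf A n)))
        (planeThrough (backPencil₁ (camerasOf A q) (formsOf A t))
          (backPencil₂ (camerasOf A q) (formsOf A t)) (centerVec (camerasOf A n)))
        (planeThrough (backPencil₁ (camerasOf A r) (formsOf A u))
          (backPencil₂ (camerasOf A r) (formsOf A u)) (centerVec (camerasOf A n)))
        (Pi.single 3 1) ≠ 0 := by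
  have h (x : Fin m) (v : S) := (IsPolyVec.backPencil₁ (isPolyVec_camerasOf x)
    (isPolyVec_formsOf v)).planeThrough (.backPencil₂ (isPolyVec_camerasOf x)
    (isPolyVec_formsOf v)) (.centerVec (isPolyVec_camerasOf n))
  refine (IsPolyVec.det4 (h p s) (h q t) (h r u) (.const _)).holdsGenerically ?_
  -- In each pencil the second vector is a coordinate plane through the center of camera `n`, and
  -- the first one misses it. The planes obtained are, up to sign, the first three coordinate
  -- planes.
  obtain ⟨A, hC, ha⟩ := exists_camerasOf_formsOf (S := S)
    (fun x => if x = n then !![1, 0, 0, 0; 0, 1, 0, 0; 0, 0, 1, 0]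
      else if x = p then !![0, 0, 0, 0; 0, 0, 0, 1; 1, 0, 0, 0]
      else if x = q then !![0, 0, 0, 0; 0, 0, 0, 1; 0, 1, 0, 0]
      else !![0, 0, 0, 0; 0, 0, 0, 1; 0, 0, 1, 0])
    fun x => ![1, 0, 0]
  exact ⟨A, by simp [hC, ha, hp, hq, hr, hpq, hpr, hqr, centerVec_standard, planeThrough,
    det4_eq, backPencil₁, backPencil₂, pencilBasis₁, pencilBasis₂]⟩

theorem generic_pencilsGeneral {i : Fin 4 → Fin m} (hi : Function.Injective i) (s : Fin 4 → S) :
    HoldsGenerically fun A : (Fin m × Fin 3 × Fin 4) ⊕ (S × Fin 3) → ℂ =>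
      PencilsGeneral (fun n => centerVec (camerasOf A n))
        (fun x => backPencil₁ (camerasOf A (i x)) (formsOf A (s x)))
        fun x => backPencil₂ (camerasOf A (i x)) (formsOf A (s x)) := by
  have he (x : Fin 4) := IsPolyVec.backPencil₁ (isPolyVec_camerasOf (i x))
    (isPolyVec_formsOf (m := m) (s x))
  have hf (x : Fin 4) := IsPolyVec.backPencil₂ (isPolyVec_camerasOf (i x))
    (isPolyVec_formsOf (m := m) (s x))
  -- For these four axes the quadratic form is `t ^ 2 - s ^ 2`, with discriminant 4.
  obtain ⟨A, hC, ha⟩ := exists_camerasOf_formsOf (S := S)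
    (Function.extend i ![!![0, 0, 0, 0; 1, 0, 0, 0; 0, 1, 0, 0],
      !![0, 0, 0, 0; 0, 0, 1, 0; 0, 0, 0, 1], !![0, 0, 0, 0; 1, 0, 1, 0; 0, 1, 0, 1],
      !![0, 0, 0, 0; 1, 0, 0, 1; 0, 1, 1, 0]] 0) fun _ => ![1, 0, 0]
  have hA₁ (x : Fin 4) : backPencil₁ (camerasOf A (i x)) (formsOf A (s x)) =
      ![![1, 0, 0, 0], ![0, 0, 1, 0], ![1, 0, 1, 0], ![1, 0, 0, 1]] x := by
    rw [hC, hi.extend_apply, ha]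
    funext k
    fin_cases x <;> fin_cases k <;>
      simp [backPencil₁, pencilBasis₁, Matrix.vecMul, dotProduct, Fin.sum_univ_three]
  have hA₂ (x : Fin 4) : backPencil₂ (camerasOf A (i x)) (formsOf A (s x)) =
      ![![0, 1, 0, 0], ![0, 0, 0, 1], ![0, 1, 0, 1], ![0, 1, 1, 0]] x := by
    rw [hC, hi.extend_apply, ha]
    funext k
    fin_cases x <;> fin_cases k <;>
      simp [backPencil₂, pencilBasis₂, Matrix.vecMul, dotProduct, Fin.sum_univ_three]
  have h₁ := (IsPolyVec.det4 (he 0) (hf 0) (he 1) (hf 1)).holdsGenerically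
    ⟨A, by simp only [hA₁, hA₂]; simp [det4_eq]⟩
  have h₂ := (IsPolyVec.incidenceDet he hf).holdsGenerically
    ⟨A, by simp only [hA₁, hA₂]; simp [incidenceDet, det4_eq]⟩
  have h₃ := (IsPolyVec.transversalCoeff₁ he hf).holdsGenerically
    ⟨A, by simp only [hA₁, hA₂]; simp [transversalCoeff₁, det4_eq]⟩
  have hdisc := (((IsPolyVec.transversalCoeff₂ he hf).mul (IsPolyVec.transversalCoeff₂ he hf)).sub
    (((IsPolyFun.const 4).mul (IsPolyVec.transversalCoeff₁ he hf)).mul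
      (IsPolyVec.transversalCoeff₃ he hf)))
  simp only [← sq] at hdisc
  have h₄ := hdisc.holdsGenerically ⟨A, by
    simp only [hA₁, hA₂]
    simp [transversalCoeff₁, transversalCoeff₂, transversalCoeff₃, det4_eq]⟩
  have h₅ : HoldsGenerically fun A : (Fin m × Fin 3 × Fin 4) ⊕ (S × Fin 3) → ℂ =>
      ∀ n, ∃ (x : Fin 3 → Fin 4) (v : Fin 4 → ℂ),
        det4 (planeThrough (backPencil₁ (camerasOf A (i (x 0))) (formsOf A (s (x 0))))
            (backPencil₂ (camerasOf A (i (x 0))) (formsOf A (s (x 0)))) (centerVec (camerasOf A n)))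
          (planeThrough (backPencil₁ (camerasOf A (i (x 1))) (formsOf A (s (x 1))))
            (backPencil₂ (camerasOf A (i (x 1))) (formsOf A (s (x 1)))) (centerVec (camerasOf A n)))
          (planeThrough (backPencil₁ (camerasOf A (i (x 2))) (formsOf A (s (x 2))))
            (backPencil₂ (camerasOf A (i (x 2))) (formsOf A (s (x 2))))
            (centerVec (camerasOf A n))) v ≠ 0 := by
    refine .all fun n => ?_
    -- If camera `n` is one of the four, its own axis is left out, since its center lies on it.
    obtain ⟨x, hx, hxn⟩ : ∃ x : Fin 3 → Fin 4, Function.Injective x ∧ ∀ y, i (x y) ≠ n := by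
      by_cases hn : ∃ z, i z = n
      · obtain ⟨z, rfl⟩ := hn
        exact ⟨z.succAbove, Fin.succAbove_right_injective,
          fun y h0 => Fin.succAbove_ne z y (hi h0)⟩
      · push Not at hn
        exact ⟨Fin.castSucc, Fin.castSucc_injective _, fun y => hn _⟩
    have hne {y z : Fin 3} (h : y ≠ z) : i (x y) ≠ i (x z) := fun h0 => h (hx (hi h0))
    exact (generic_planeThrough (hxn 0) (hxn 1) (hxn 2) (hne (by decide)) (hne (by decide))
      (hne (by decide)) (s (x 0)) (s (x 1)) (s (x 2))).mono fun A hA => ⟨x, _, hA⟩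
  exact ((((h₁.and h₂).and h₃).and h₄).and h₅).mono fun A hA =>
    ⟨hA.1.1.1.1, hA.1.1.1.2, hA.1.1.2, hA.1.2, hA.2⟩

end CamerasAndForms

/-! ### Linear sections and multidegrees -/

section LinearSections

variable {m : ℕ} {d : Fin m → ℕ}

theorem linearSubspaceProduct_two_two {i j : Fin m} (hi : d i = 2) (hj : d j = 2)
    (h0 : ∀ n, n ≠ i → n ≠ j → d n = 0) (a : (Σ i : Fin m, Fin (d i)) × Fin 3 → ℂ) :
    linearSubspaceProduct d a = {ℓ |
      (fun k => a (⟨i, ⟨0, by omega⟩⟩, k)) ⬝ᵥ (ℓ i).rep = 0 ∧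
      (fun k => a (⟨i, ⟨1, by omega⟩⟩, k)) ⬝ᵥ (ℓ i).rep = 0 ∧
      (fun k => a (⟨j, ⟨0, by omega⟩⟩, k)) ⬝ᵥ (ℓ j).rep = 0 ∧
      (fun k => a (⟨j, ⟨1, by omega⟩⟩, k)) ⬝ᵥ (ℓ j).rep = 0} := by
  ext ℓ
  refine ⟨fun h => ⟨h i _, h i _, h j _, h j _⟩, ?_⟩
  rintro ⟨h1, h2, h3, h4⟩ n ⟨q, hq⟩
  by_cases hni : n = i
  · subst hni
    obtain rfl | rfl : q = 0 ∨ q = 1 := by omega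
    exacts [h1, h2]
  by_cases hnj : n = j
  · subst hnj
    obtain rfl | rfl : q = 0 ∨ q = 1 := by omega
    exacts [h3, h4]
  have := h0 n hni hnj
  omega

theorem linearSubspaceProduct_two_one_one {i j k : Fin m} (hi : d i = 2) (hj : d j = 1)
    (hk : d k = 1) (h0 : ∀ n, n ≠ i → n ≠ j → n ≠ k → d n = 0)
    (a : (Σ i : Fin m, Fin (d i)) × Fin 3 → ℂ) :
    linearSubspaceProduct d a = {ℓ |
      (fun k => a (⟨i, ⟨0, by omega⟩⟩, k)) ⬝ᵥ (ℓ i).rep = 0 ∧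
      (fun k => a (⟨i, ⟨1, by omega⟩⟩, k)) ⬝ᵥ (ℓ i).rep = 0 ∧
      (fun k => a (⟨j, ⟨0, by omega⟩⟩, k)) ⬝ᵥ (ℓ j).rep = 0 ∧
      (fun q => a (⟨k, ⟨0, by omega⟩⟩, q)) ⬝ᵥ (ℓ k).rep = 0} := by
  ext ℓ
  refine ⟨fun h => ⟨h i _, h i _, h j _, h k _⟩, ?_⟩
  rintro ⟨h1, h2, h3, h4⟩ n ⟨q, hq⟩
  by_cases hni : n = i
  · subst hni
    obtain rfl | rfl : q = 0 ∨ q = 1 := by omega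
    exacts [h1, h2]
  by_cases hnj : n = j
  · subst hnj
    obtain rfl : q = 0 := by omega
    exact h3
  by_cases hnk : n = k
  · subst hnk
    obtain rfl : q = 0 := by omega
    exact h4
  have := h0 n hni hnj hnk
  omega

theorem linearSubspaceProduct_ones {i : Fin 4 → Fin m} (hi : ∀ x, d (i x) = 1)
    (h0 : ∀ n, (∀ x, n ≠ i x) → d n = 0) (a : (Σ i : Fin m, Fin (d i)) × Fin 3 → ℂ) :
    linearSubspaceProduct d a = {ℓ | ∀ x,
      (fun k => a (⟨i x, ⟨0, by have := hi x; omega⟩⟩, k)) ⬝ᵥ (ℓ (i x)).rep = 0} := by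
  ext ℓ
  refine ⟨fun h x => h (i x) _, ?_⟩
  rintro h n ⟨q, hq⟩
  by_cases hn : ∃ x, n = i x
  · obtain ⟨x, rfl⟩ := hn
    obtain rfl : q = 0 := by
      have := hi x
      omega
    exact h x
  · push Not at hn
    have := h0 n hn
    omega

/-- Three general linear forms on `ℂ³` have no nonzero common zero, so the section is empty whatever
`X` is; the coordinate forms are the witness. -/
theorem multidegreeEq_zero (X : Set (Fin m → PTwo)) {i : Fin m} (hi : 3 ≤ d i) :
    MultidegreeEq X d 0 := by
  have hdet : IsPolyFun fun a : (Σ i : Fin m, Fin (d i)) × Fin 3 → ℂ =>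
      (Matrix.of fun r k : Fin 3 => a (⟨i, ⟨r, by omega⟩⟩, k)).det :=
    .det fun r k => .coord ((⟨i, ⟨r, by omega⟩⟩, k) : (Σ i : Fin m, Fin (d i)) × Fin 3)
  refine (hdet.holdsGenerically
    ⟨fun v => if v.1.2.val = v.2.val then 1 else 0, ?_⟩).mono fun a ha => ?_
  · have : (Matrix.of fun r k : Fin 3 => if r.val = k.val then (1 : ℂ) else 0) = 1 := by
      ext r k
      simp [Matrix.one_apply, Fin.ext_iff]
    simp [this]
  · rw [Nat.cast_zero, Set.encard_eq_zero, Set.eq_empty_iff_forall_notMem]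
    rintro ℓ ⟨-, hℓ⟩
    exact (ℓ i).rep_nonzero (Matrix.eq_zero_of_mulVec_eq_zero ha
      (funext fun r => hℓ i ⟨r, by omega⟩))

theorem generic_multidegreeEq {n : ℕ}
    (h : HoldsGenerically fun A : (Fin m × Fin 3 × Fin 4) ⊕ ((Σ i : Fin m, Fin (d i)) × Fin 3) → ℂ =>
      (lineMultiviewVariety (camerasOf A) ∩
        linearSubspaceProduct d fun v => A (.inr v)).encard = n) :
    HoldsGenerically fun A : Fin m × Fin 3 × Fin 4 → ℂ =>
      MultidegreeEq (lineMultiviewVariety (cameraTuple A)) d n :=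
  HoldsGenerically.curry (R := fun A b =>
    (lineMultiviewVariety (cameraTuple A) ∩ linearSubspaceProduct d b).encard = n) h

theorem generic_multidegreeEq_two_two {i j : Fin m} (hij : i ≠ j) (hi : d i = 2) (hj : d j = 2)
    (h0 : ∀ n, n ≠ i → n ≠ j → d n = 0) :
    HoldsGenerically fun A : Fin m × Fin 3 × Fin 4 → ℂ =>
      MultidegreeEq (lineMultiviewVariety (cameraTuple A)) d 1 := by
  have h₁ := HoldsGenerically.all fun n => HoldsGenerically.imp fun hn : n ≠ i =>
    generic_cross_dotProduct (S := Σ i : Fin m, Fin (d i)) hn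
      (s := ⟨i, ⟨0, by omega⟩⟩) (s' := ⟨i, ⟨1, by omega⟩⟩) (by simp)
  have h₂ := HoldsGenerically.all fun n => HoldsGenerically.imp fun hn : n ≠ j =>
    generic_cross_dotProduct (S := Σ i : Fin m, Fin (d i)) hn
      (s := ⟨j, ⟨0, by omega⟩⟩) (s' := ⟨j, ⟨1, by omega⟩⟩) (by simp)
  refine generic_multidegreeEq
    ((generic_centerVec_camerasOf_ne_zero.and (h₁.and h₂)).mono fun A hA => ?_)
  obtain ⟨ℓ, hℓ⟩ := exists_eq_singleton_of_two_points hA.1 hA.2.1 hA.2.2 hij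
  rw [linearSubspaceProduct_two_two hi hj h0, Nat.cast_one, Set.encard_eq_one]
  exact ⟨ℓ, hℓ⟩

theorem generic_multidegreeEq_two_one_one {i j k : Fin m} (hij : i ≠ j) (hik : i ≠ k) (hjk : j ≠ k)
    (hi : d i = 2) (hj : d j = 1) (hk : d k = 1)
    (h0 : ∀ n, n ≠ i → n ≠ j → n ≠ k → d n = 0) :
    HoldsGenerically fun A : Fin m × Fin 3 × Fin 4 → ℂ =>
      MultidegreeEq (lineMultiviewVariety (cameraTuple A)) d 1 := by
  let s : Σ i : Fin m, Fin (d i) := ⟨i, ⟨0, by omega⟩⟩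
  let s' : Σ i : Fin m, Fin (d i) := ⟨i, ⟨1, by omega⟩⟩
  let u : Σ i : Fin m, Fin (d i) := ⟨j, ⟨0, by omega⟩⟩
  let v : Σ i : Fin m, Fin (d i) := ⟨k, ⟨0, by omega⟩⟩
  have hs : s ≠ s' := by simp [s, s']
  have hu : u ≠ s' := fun h => hij (congrArg Sigma.fst h).symm
  have hv : v ≠ s' := fun h => hik (congrArg Sigma.fst h).symm
  have h₁ := HoldsGenerically.all fun n => HoldsGenerically.imp fun hn : n ≠ i =>
    generic_cross_dotProduct hn hs
  refine generic_multidegreeEq (((((generic_centerVec_camerasOf_ne_zero.and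
    (generic_form_ne_zero u)).and (generic_form_ne_zero v)).and h₁).and
    ((generic_det4_cross hij hik hjk hs hu hv).and
      (generic_joinPlane hij hik hjk hs hu hv))).mono fun A hA => ?_)
  obtain ⟨⟨⟨⟨hC, hβ⟩, hγ⟩, hg⟩, hdet, hw⟩ := hA
  obtain ⟨ℓ, hℓ⟩ := exists_eq_singleton_of_point_of_two_lines hC hβ hγ hg hdet hw
  rw [linearSubspaceProduct_two_one_one hi hj hk h0, Nat.cast_one, Set.encard_eq_one]
  exact ⟨ℓ, hℓ⟩

theorem generic_multidegreeEq_ones {i : Fin 4 → Fin m} (hinj : Function.Injective i)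
    (hi : ∀ x, d (i x) = 1) (h0 : ∀ n, (∀ x, n ≠ i x) → d n = 0) :
    HoldsGenerically fun A : Fin m × Fin 3 × Fin 4 → ℂ =>
      MultidegreeEq (lineMultiviewVariety (cameraTuple A)) d 2 := by
  let s (x : Fin 4) : Σ i : Fin m, Fin (d i) := ⟨i x, ⟨0, by have := hi x; omega⟩⟩
  refine generic_multidegreeEq (((generic_centerVec_camerasOf_ne_zero.and
    (HoldsGenerically.all fun x => generic_form_ne_zero (s x))).and
    (generic_pencilsGeneral hinj s)).mono fun A hA => ?_)
  rw [linearSubspaceProduct_ones hi h0]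
  exact encard_eq_two_of_four_lines hA.1.1 hA.1.2 hA.2

end LinearSections

theorem theorem4p1 (m : ℕ) (hm : 2 ≤ m) :
    HoldsGenerically fun a : Fin m × Fin 3 × Fin 4 → ℂ =>
      IsCameraArrangement (cameraTuple a) ∧ NoFourCollinear (cameraTuple a) ∧
      (∀ i j : Fin m, [i, j].Nodup →
        MultidegreeEq (lineMultiviewVariety (cameraTuple a))
          (Pi.single i 2 + Pi.single j 2) 1) ∧
      (∀ i j k : Fin m, [i, j, k].Nodup →
        MultidegreeEq (lineMultiviewVariety (cameraTuple a))
          (Pi.single i 2 + Pi.single j 1 + Pi.single k 1) 1) ∧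
      (∀ i j k l : Fin m, [i, j, k, l].Nodup →
        MultidegreeEq (lineMultiviewVariety (cameraTuple a))
          (Pi.single i 1 + Pi.single j 1 + Pi.single k 1 + Pi.single l 1) 2) ∧
      (∀ d : Fin m → ℕ, ∑ i, d i = 4 → (∃ i, 3 ≤ d i) →
        MultidegreeEq (lineMultiviewVariety (cameraTuple a)) d 0) := by
  -- Each remaining clause runs over finitely many index tuples, so one product of polynomials
  -- serves them all. The clause on `d` with an entry at least 3 holds for every tuple of cameras.
  refine ((generic_centerVec_ne_zero.and generic_center_ne).mono fun A hA =>
    ⟨fun i => rank_eq_three (hA.1 i), hA.2⟩).and (generic_noFourCollinear.and (.and ?_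
      (.and ?_ (.and ?_ (.of_forall fun A d _ ⟨i, hi⟩ => multidegreeEq_zero _ hi)))))
  · refine .all fun i => .all fun j => .imp fun h => ?_
    have hij : i ≠ j := by simpa using h
    refine generic_multidegreeEq_two_two hij ?_ ?_ fun n hni hnj => ?_
    · simp [hij]
    · simp [hij.symm]
    · simp [hni, hnj]
  · refine .all fun i => .all fun j => .all fun k => .imp fun h => ?_
    obtain ⟨⟨hij, hik⟩, hjk⟩ : (i ≠ j ∧ i ≠ k) ∧ j ≠ k := by simpa using h
    refine generic_multidegreeEq_two_one_one hij hik hjk ?_ ?_ ?_ fun n hni hnj hnk => ?_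
    · simp [hij, hik]
    · simp [hij.symm, hjk]
    · simp [hik.symm, hjk.symm]
    · simp [hni, hnj, hnk]
  · refine .all fun i => .all fun j => .all fun k => .all fun l => .imp fun h => ?_
    have hinj : Function.Injective ![i, j, k, l] := List.nodup_ofFn.1 (by simpa using h)
    obtain ⟨⟨hij, hik, hil⟩, ⟨hjk, hjl⟩, hkl⟩ :
        (i ≠ j ∧ i ≠ k ∧ i ≠ l) ∧ (j ≠ k ∧ j ≠ l) ∧ k ≠ l := by simpa using h
    refine generic_multidegreeEq_ones hinj (fun x => ?_) fun n hn => ?_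
    · fin_cases x
      · simp [hij, hik, hil]
      · simp [hij.symm, hjk, hjl]
      · simp [hik.symm, hjk.symm, hkl]
      · simp [hil.symm, hjl.symm, hkl.symm]
    · have h0 : n ≠ i := hn 0
      have h1 : n ≠ j := hn 1
      have h2 : n ≠ k := hn 2
      have h3 : n ≠ l := hn 3
      simp [h0, h1, h2, h3]
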